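/- Let $n\ge 1$ and let $f\in\mathbb{C}[z_0,\dots,z_n]$ be quasihomogeneous, i.e. there are positive integers $\beta_0,\dots,\beta_n,\beta$ with $f(t^{\beta_0}z_0,\dots,t^{\beta_n}z_n)=t^{\beta}f(z)$ for all $t\in\mathbb{C}^*$, and assume that $0$ is an isolated critical point of $f$. Let $\sigma(t)(z)=(e^{2\pi i t\beta_0}z_0,\dots,e^{2\pi i t\beta_n}z_n)$. Let $\psi:\mathbb{R}\to[0,1]$ be a smooth cutoff function such that, for some $0<a<b<1$, $\psi(s)=1$ for $s\le a$ and $\psi(s)=0$ for $s\ge b$, and let $\delta>0$. Consider the Milnor fibration perturbed near its boundary, $$X=\{(z,u)\in\mathbb{C}^{n+1}\times\mathbb{C} : |u|=\delta,\ |z|\le 1,\ f(z)=\psi(|z|^2)\,u\},\qquad (z,u)\mapsto u\in S^1_\delta ,$$ (for small $\delta$ this is a smooth fibration; the assertions below hold for every $\delta>0$), and its $\beta$-fold cyclic covering $\tilde X=\{(z,v): |v|=1,\ (z,\delta v^\beta)\in X\}\to S^1$, $(z,v)\mapsto v$, with fibres $\tilde X_v\subset\mathbb{C}^{n+1}$ and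 boundary $\partial\tilde X=\tilde X\cap\{|z|=1\}$, $\partial\tilde X_v=\tilde X_v\cap\{|z|=1\}$. The action $\sigma$ lifts to $\tilde\sigma(t)(z,v)=(\sigma(t)z,e^{2\pi it}v)$ on $\tilde X$. Fix $x\in S^1$, let $F=\tilde X_x$ and $\rho_F=\sigma(1/\beta)$, and let $\rho_{\tilde X}:\tilde X\to\tilde X$ be given over $v=xe^{2\pi i t}$ by $\rho_{\tilde X}=\tilde\sigma(t)\circ\rho_F\circ\tilde\sigma(t)^{-1}$. Then $\partial\tilde X_v=\partial F$ for all $v\in S^1$, so that $\partial\tilde X=\partial F\times S^1$ in $\mathbb{C}^{n+1}\times\mathbb{C}$; $\partial F$ is a smooth $(2n-1)$-dimensional submanifold of $\mathbb{C}^{n+1}$, and there is a one-form $\eta$ which is a contact form on $\partial\tilde X_v=\partial F$ for every $v\in S^1$, such that the following holds. Let $\mathcal{B}$ be the Reeb vector field of $\eta$ (tangent to $\partial F$, with $\eta(\mathcal{B})=1$ and $d\eta(\mathcal{B},\cdot)=0$ on $T\partial F$), let $\Theta=\ker\eta\subset T\partial F$ be the contact distribution, and, for $v\in S^1$, let $N$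 be the gradient, with respect to the metric on $\tilde X_v$ induced from the Euclidean metric of $\mathbb{C}^{n+1}$, of the restriction to $\tilde X_v$ of the radius function $|z|$. 1. For every $v\in S^1$ and at every point of $\partial\tilde X_v$, $N\ne 0$ and $$T\tilde X_v|_{\partial\tilde X_v}=\mathbb{R}N\oplus\mathbb{R}\mathcal{B}\oplus\Theta ,\qquad N\perp\Theta .$$ 2. All leaves of the foliation of $\partial F$ given by $\mathcal{B}$ are closed curves (homeomorphic to a circle), and the flow of $\mathcal{B}$ is a flow $\sigma_{\mathcal{B}}:S^1\times\partial F\to\partial F$, where $S^1=\mathbb{R}/\mathbb{Z}=[0,1]/\{0,1\}$. 3. Put $\tilde\sigma_{\mathcal{B}}=\sigma_{\mathcal{B}}\times \mathrm{id}_{S^1}$ on $\partial\tilde X=\partial F\times S^1$, and let $L^2(\Omega^*_{\partial\tilde X})$ be the Hilbert space of square integrable complex valued differential forms of all degrees on $\partial\tilde X$, for the product metric of $\partial F\times S^1$. The pullbacks of forms by the restriction of $\rho_{\tilde X}$ to $\partial\tilde X$ and by $\tilde\sigma_{\mathcal{B}}(1/\beta)$ are bounded operators on it, and they are equal: $$\rho_{\tilde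 X}^*|_{\partial\tilde X}=\big(\tilde\sigma_{\mathcal{B}}(1/\beta)\big)^*\in \mathrm{B}\big(L^2(\Omega^*_{\partial\tilde X})\big).$$ -/

import Mathlib

open MeasureTheory Topology
open scoped ContDiff RealInnerProductSpace

noncomputable section

namespace MilnorReeb

/-! ### Embedded submanifolds of a Euclidean space, tangent spaces, contact forms -/

section Submanifolds

/-- `M` is an embedded smooth submanifold (without boundary) of dimension `d` of the finite
dimensional space `E`: locally it is a regular level set of a smooth map to `ℝᶜ`,
`c = dim E - d`. -/
def IsSmoothSubmanifold {E : Type*} [NormedAddCommGroup E] [NormedSpace ℝ E]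
    (d : ℕ) (M : Set E) : Prop :=
  ∀ p ∈ M, ∃ (c : ℕ) (U : Set E) (g : E → Fin c → ℝ),
    c + d = Module.finrank ℝ E ∧ IsOpen U ∧ p ∈ U ∧ ContDiffOn ℝ ∞ g U ∧
    Function.Surjective (fderiv ℝ g p) ∧ M ∩ U = {q | q ∈ U ∧ g q = 0}

/-- The tangent space at `p` of a subset `M` of `E`: the linear span of the tangent cone. For a
submanifold, with or without boundary, this is the usual tangent space (at a boundary
point the tangent cone is a half space, and its span is the full tangent space). -/
def tangentSpaceAt {E : Type*} [NormedAddCommGroup E] [NormedSpace ℝ E]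
    (M : Set E) (p : E) : Submodule ℝ E :=
  Submodule.span ℝ (tangentConeAt ℝ M p)

/-- `η` restricts to a contact form on the `d`-dimensional submanifold `M`. A smooth one-form on
`M` is represented by a smooth one-form on a neighbourhood of `M`; only its restriction to the
tangent spaces of `M` matters. The contact condition says that `η` vanishes
nowhere on `M` and that `dη` is nondegenerate on the contact distribution `ker η`. -/
def IsContactForm {E : Type*} [NormedAddCommGroup E] [NormedSpace ℝ E]
    (d : ℕ) (M : Set E) (η : E → E [⋀^Fin 1]→L[ℝ] ℝ) : Prop :=
  IsSmoothSubmanifold d M ∧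
  (∃ U : Set E, IsOpen U ∧ M ⊆ U ∧ ContDiffOn ℝ ∞ η U) ∧
  ∀ p ∈ M,
    (∃ v ∈ tangentSpaceAt M p, η p ![v] ≠ 0) ∧
    ∀ v ∈ tangentSpaceAt M p, η p ![v] = 0 → v ≠ 0 →
      ∃ w ∈ tangentSpaceAt M p, η p ![w] = 0 ∧ extDeriv η p ![v, w] ≠ 0

/-- The contact distribution `Θ = ker η ⊆ TM` at the point `p`. -/
def contactDistribution {E : Type*} [NormedAddCommGroup E] [NormedSpace ℝ E]
    (M : Set E) (η : E → E [⋀^Fin 1]→L[ℝ] ℝ) (p : E) : Submodule ℝ E where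
  carrier := {v | v ∈ tangentSpaceAt M p ∧ η p ![v] = 0}
  zero_mem' := ⟨Submodule.zero_mem _, (η p).map_coord_zero 0 rfl⟩
  add_mem' := by
    rintro a b ⟨ha, ha'⟩ ⟨hb, hb'⟩
    refine ⟨Submodule.add_mem _ ha hb, ?_⟩
    have h := (η p).map_update_add ![a] 0 a b
    have e : ∀ x : E, Function.update ![a] 0 x = ![x] := by
      intro x; ext i; fin_cases i; rfl
    rw [e, e, e, ha', hb', add_zero] at h
    exact h
  smul_mem' := by
    rintro c a ⟨ha, ha'⟩
    refine ⟨Submodule.smul_mem _ c ha, ?_⟩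
    have h := (η p).map_update_smul ![a] 0 c a
    have e : ∀ x : E, Function.update ![a] 0 x = ![x] := by
      intro x; ext i; fin_cases i; rfl
    rw [e, e, ha', smul_zero] at h
    exact h

/-- `B` is the Reeb vector field of the contact form `η` on `M`: it is tangent to `M`, `η(B) = 1`,
and `dη(B, ·) = 0` on `TM`. -/
def IsReebField {E : Type*} [NormedAddCommGroup E] [NormedSpace ℝ E]
    (M : Set E) (η : E → E [⋀^Fin 1]→L[ℝ] ℝ) (B : E → E) : Prop :=
  ∀ p ∈ M, B p ∈ tangentSpaceAt M p ∧ η p ![B p] = 1 ∧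
    ∀ w ∈ tangentSpaceAt M p, extDeriv η p ![B p, w] = 0

/-- The leaf through `p` of the one-dimensional foliation of `M` generated by the vector field
`B`: all points reached from `p` along integral curves of `B` in `M`. -/
def leaf {E : Type*} [NormedAddCommGroup E] [NormedSpace ℝ E]
    (M : Set E) (B : E → E) (p : E) : Set E :=
  {q | ∃ γ : ℝ → E, (∀ t, γ t ∈ M ∧ HasDerivAt γ (B (γ t)) t) ∧ γ 0 = p ∧ ∃ t, γ t = q}

/-- `σ : S¹ × M → M`, `S¹ = ℝ/ℤ`, is the flow on `M` of the vector field `B`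
(only the values of `σ` at points of `M` matter). -/
def IsCircleFlow {E : Type*} [NormedAddCommGroup E] [NormedSpace ℝ E]
    (M : Set E) (B : E → E) (σ : AddCircle (1 : ℝ) → E → E) : Prop :=
  ∀ p ∈ M, σ 0 p = p ∧ ∀ t : ℝ, σ t p ∈ M ∧
    HasDerivAt (fun s : ℝ => σ s p) (B (σ t p)) t

/-- The gradient on `F`, for the metric induced from the ambient Euclidean space, of the
restriction to `F` of the Euclidean radius function `r(z) = ‖z‖`. -/
def radialGradient {E : Type*} [NormedAddCommGroup E] [InnerProductSpace ℝ E]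
    [FiniteDimensional ℝ E] (F : Set E) (p : E) : E :=
  (tangentSpaceAt F p).starProjection (gradient (fun z : E => ‖z‖) p)

end Submanifolds

/-! ### The Hilbert space of square integrable forms on an embedded submanifold -/

section SquareIntegrableForms

/-- Complex valued exterior forms of all degrees on `E`. -/
abbrev ExteriorForms (E : Type*) [NormedAddCommGroup E] [NormedSpace ℝ E] : Type _ :=
  (k : Fin (Module.finrank ℝ E + 1)) → E [⋀^Fin k]→L[ℝ] ℂ

/-- Multi-indices of all lengths `k ≤ dim E`. -/
abbrev FormIndex (E : Type*) [NormedAddCommGroup E] [NormedSpace ℝ E] : Type :=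
  Σ k : Fin (Module.finrank ℝ E + 1), (Fin k → Fin (Module.finrank ℝ E))

/-- The coefficients of a form in an orthonormal basis `e` of `E`, scaled so that the Euclidean
norm of the coefficient vector is the usual norm of the form:
`∑_I |α(e_I)|² / k! = ∑_{i₁ < ⋯ < i_k} |α(e_{i₁}, …, e_{i_k})|²`. -/
def formCoord (E : Type*) [NormedAddCommGroup E] [InnerProductSpace ℝ E]
    [FiniteDimensional ℝ E] : ExteriorForms E →ₗ[ℂ] EuclideanSpace ℂ (FormIndex E) where
  toFun α := WithLp.toLp 2 fun I =>
    (((Real.sqrt (Nat.factorial I.1))⁻¹ : ℝ) : ℂ) *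
      α I.1 (fun j => stdOrthonormalBasis ℝ E (I.2 j))
  map_add' α α' := by
    ext I
    simp [mul_add]
  map_smul' c α := by
    ext I
    simp [mul_left_comm]

/-- The pullback of exterior forms along a linear map. -/
def formPullback {E : Type*} [NormedAddCommGroup E] [NormedSpace ℝ E]
    (A : E →L[ℝ] E) (α : ExteriorForms E) : ExteriorForms E :=
  fun k => (α k).compContinuousLinearMap A

/-- The forms on the tangent space `T_pM`. A form on the subspace `T_pM` is represented by its
pullback to `E` along the orthogonal projection onto `T_pM`, which has the same norm. -/
def tangentialForms {E : Type*} [NormedAddCommGroup E] [InnerProductSpace ℝ E]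
    [FiniteDimensional ℝ E] (M : Set E) (p : E) : Submodule ℂ (ExteriorForms E) where
  carrier := {α | formPullback (tangentSpaceAt M p).starProjection α = α}
  zero_mem' := by
    funext k; ext v; simp [formPullback]
  add_mem' := by
    intro a b ha hb
    have h : formPullback (tangentSpaceAt M p).starProjection (a + b) =
        formPullback (tangentSpaceAt M p).starProjection a +
          formPullback (tangentSpaceAt M p).starProjection b := by
      funext k; ext v; simp [formPullback]
    simp only [Set.mem_ofPred_eq] at ha hb ⊢
    rw [h, ha, hb]
  smul_mem' := by
    intro c a ha
    have h : formPullback (tangentSpaceAt M p).starProjection (c • a) =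
        c • formPullback (tangentSpaceAt M p).starProjection a := by
      funext k; ext v; simp [formPullback]
    simp only [Set.mem_ofPred_eq] at ha ⊢
    rw [h, ha]

/-- The Riemannian volume measure of the `d`-dimensional submanifold `M` of `E`
(normalized `d`-dimensional Hausdorff measure). -/
def volumeOn {E : Type*} [NormedAddCommGroup E] [MeasurableSpace E] [BorelSpace E]
    (d : ℕ) (M : Set E) : Measure E :=
  (Measure.euclideanHausdorffMeasure d : Measure E).restrict M

/-- `L²(Ω*(M))`: the Hilbert space of square integrable complex valued differential forms of all
degrees on the `d`-dimensional submanifold `M` of `E`, for the induced Riemannian metric. -/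
def L2Forms {E : Type*} [NormedAddCommGroup E] [InnerProductSpace ℝ E]
    [FiniteDimensional ℝ E] [MeasurableSpace E] [BorelSpace E] (d : ℕ) (M : Set E) :
    Submodule ℂ (Lp (EuclideanSpace ℂ (FormIndex E)) 2 (volumeOn d M)) where
  carrier := {u | ∀ᵐ p ∂(volumeOn d M), u p ∈ (tangentialForms M p).map (formCoord E)}
  zero_mem' := by
    filter_upwards [Lp.coeFn_zero (EuclideanSpace ℂ (FormIndex E)) 2 (volumeOn d M)] with p hp
    rw [hp]
    exact Submodule.zero_mem _
  add_mem' := by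
    intro a b ha hb
    filter_upwards [ha, hb, Lp.coeFn_add a b] with p hpa hpb hp
    rw [hp]
    exact Submodule.add_mem _ hpa hpb
  smul_mem' := by
    intro c a ha
    filter_upwards [ha, Lp.coeFn_smul c a] with p hpa hp
    rw [hp]
    exact Submodule.smul_mem _ c hpa

/-- The field of forms `α` on `M` represents the class `u ∈ L²(Ω*(M))`. -/
def Represents {E : Type*} [NormedAddCommGroup E] [InnerProductSpace ℝ E]
    [FiniteDimensional ℝ E] [MeasurableSpace E] [BorelSpace E] {d : ℕ} {M : Set E}
    (α : E → ExteriorForms E) (u : L2Forms d M) : Prop :=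
  ∀ᵐ p ∂(volumeOn d M), α p ∈ tangentialForms M p ∧
    (u : Lp (EuclideanSpace ℂ (FormIndex E)) 2 (volumeOn d M)) p = formCoord E (α p)

/-- The bounded operator `T` on `L²(Ω*(M))` is the pullback `φ^*` of forms along the
differentiable map `φ : M → M`, that is `(φ^* α)_p = α_{φ(p)} ∘ (dφ_p)` on `T_pM`.
The derivative of `φ` within `M` is determined on `T_pM`. -/
def IsPullbackOperator {E : Type*} [NormedAddCommGroup E] [InnerProductSpace ℝ E]
    [FiniteDimensional ℝ E] [MeasurableSpace E] [BorelSpace E] {d : ℕ} {M : Set E}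
    (φ : E → E) (T : L2Forms d M →L[ℂ] L2Forms d M) : Prop :=
  Set.MapsTo φ M M ∧ DifferentiableOn ℝ φ M ∧
  ∀ (α : E → ExteriorForms E) (u : L2Forms d M), Represents α u →
    Represents (fun p => formPullback
      ((fderivWithin ℝ φ M p).comp (tangentSpaceAt M p).starProjection) (α (φ p))) (T u)

end SquareIntegrableForms

/-! ### Quasihomogeneous singularities and the Milnor fibration -/

section Milnor

/-- The space `ℂⁿ⁺¹` with its Hermitian norm. -/
abbrev CSpace (n : ℕ) : Type := EuclideanSpace ℂ (Fin (n + 1))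

/-- The space `ℂⁿ⁺¹ × ℂ` with the Euclidean product norm. -/
abbrev CSpaceProd (n : ℕ) : Type := WithLp 2 (CSpace n × ℂ)

/-- `f(t^{β₀} z₀, …, t^{βₙ} zₙ) = t^β f(z)` for all `t ∈ ℂ^*`, with positive integers `βᵢ`, `β`. -/
def IsQuasihomogeneous {n : ℕ} (f : MvPolynomial (Fin (n + 1)) ℂ) (b : Fin (n + 1) → ℕ)
    (β : ℕ) : Prop :=
  (∀ i, 0 < b i) ∧ 0 < β ∧ ∀ t : ℂ, t ≠ 0 → ∀ z : Fin (n + 1) → ℂ,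
    MvPolynomial.eval (fun i => t ^ b i * z i) f = t ^ β * MvPolynomial.eval z f

/-- The origin is an isolated critical point of `f`. -/
def HasIsolatedSingularity {n : ℕ} (f : MvPolynomial (Fin (n + 1)) ℂ) : Prop :=
  (∀ i, MvPolynomial.eval 0 (MvPolynomial.pderiv i f) = 0) ∧
  ∀ᶠ z in 𝓝[≠] (0 : Fin (n + 1) → ℂ), ∃ i, MvPolynomial.eval z (MvPolynomial.pderiv i f) ≠ 0

/-- A smooth cutoff function with values in `[0, 1]`, equal to `1` near `0` and below, and equal
to `0` near `1` and above. -/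
def IsCutoff (ψ : ℝ → ℝ) : Prop :=
  ContDiff ℝ ∞ ψ ∧ (∀ s, 0 ≤ ψ s ∧ ψ s ≤ 1) ∧
  ∃ a b : ℝ, 0 < a ∧ a < b ∧ b < 1 ∧ (∀ s ≤ a, ψ s = 1) ∧ ∀ s ≥ b, ψ s = 0

/-- The fibre over `u` of the Milnor fibration of `f` perturbed near the boundary:
`{z ∈ B²ⁿ⁺² : f(z) = ψ(|z|²) u}`. -/
def milnorFibre {n : ℕ} (f : MvPolynomial (Fin (n + 1)) ℂ) (ψ : ℝ → ℝ) (u : ℂ) :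
    Set (CSpace n) :=
  {z | ‖z‖ ≤ 1 ∧ MvPolynomial.eval (fun i => z i) f = (ψ (‖z‖ ^ 2) : ℂ) * u}

/-- The total space `X` over the circle `S¹_δ` of radius `δ`; the projection is `(z, u) ↦ u`. -/
def milnorBundle {n : ℕ} (f : MvPolynomial (Fin (n + 1)) ℂ) (ψ : ℝ → ℝ) (δ : ℝ) :
    Set (CSpaceProd n) :=
  {p | ‖p.snd‖ = δ ∧ p.fst ∈ milnorFibre f ψ p.snd}

/-- The `β`-fold cyclic covering `X̃` of `X`: the pullback of `X → S¹_δ` along `S¹ → S¹_δ`,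
`v ↦ δ v^β`, with projection `(z, v) ↦ v` to `S¹`. -/
def cyclicCover {n : ℕ} (f : MvPolynomial (Fin (n + 1)) ℂ) (ψ : ℝ → ℝ) (δ : ℝ) (β : ℕ) :
    Set (CSpaceProd n) :=
  {p | ‖p.snd‖ = 1 ∧ WithLp.toLp 2 (p.fst, (δ : ℂ) * p.snd ^ β) ∈ milnorBundle f ψ δ}

/-- The boundary `∂X̃`. -/
def coverBoundary {n : ℕ} (f : MvPolynomial (Fin (n + 1)) ℂ) (ψ : ℝ → ℝ) (δ : ℝ) (β : ℕ) :
    Set (CSpaceProd n) :=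
  {p | p ∈ cyclicCover f ψ δ β ∧ ‖p.fst‖ = 1}

/-- The fibre `X̃_v` of `X̃` over `v ∈ S¹`. -/
def coverFibre {n : ℕ} (f : MvPolynomial (Fin (n + 1)) ℂ) (ψ : ℝ → ℝ) (δ : ℝ) (β : ℕ)
    (v : ℂ) : Set (CSpace n) :=
  {z | WithLp.toLp 2 (z, v) ∈ cyclicCover f ψ δ β}

/-- The boundary `∂X̃_v` of the fibre of `X̃` over `v ∈ S¹`. -/
def coverFibreBoundary {n : ℕ} (f : MvPolynomial (Fin (n + 1)) ℂ) (ψ : ℝ → ℝ) (δ : ℝ) (β : ℕ)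
    (v : ℂ) : Set (CSpace n) :=
  coverFibre f ψ δ β v ∩ Metric.sphere 0 1

/-- The weighted circle action `σ(t)(z) = (e^{2πi t β₀} z₀, …, e^{2πi t βₙ} zₙ)`. -/
def weightedCircleAction {n : ℕ} (b : Fin (n + 1) → ℕ) (t : ℝ) (z : CSpace n) : CSpace n :=
  WithLp.toLp 2 fun i => Complex.exp (2 * Real.pi * Complex.I * t * b i) * z i

/-- The lift `σ̃(t)(z, v) = (σ(t) z, e^{2πi t} v)` of the weighted circle action to `X̃`. -/
def liftedCircleAction {n : ℕ} (b : Fin (n + 1) → ℕ) (t : ℝ) (p : CSpaceProd n) :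
    CSpaceProd n :=
  WithLp.toLp 2 (weightedCircleAction b t p.fst, Complex.exp (2 * Real.pi * Complex.I * t) * p.snd)

/-- The representative `ρ_F = σ(1/β)` of the geometric monodromy, acting on a fixed fibre. -/
def fibreMonodromy {n : ℕ} (b : Fin (n + 1) → ℕ) (β : ℕ) (p : CSpaceProd n) : CSpaceProd n :=
  WithLp.toLp 2 (weightedCircleAction b (1 / (β : ℝ)) p.fst, p.snd)

/-- The monodromy isometry `ρ_X̃ = σ̃(t) ∘ ρ_F ∘ σ̃(t)⁻¹` at a point over `v = x e^{2πi t}`, where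
`F = X̃_x` is the fixed fibre; the angle `t` is taken from the argument of `v / x`. -/
def coverMonodromy {n : ℕ} (b : Fin (n + 1) → ℕ) (β : ℕ) (x : ℂ) (p : CSpaceProd n) :
    CSpaceProd n :=
  let t : ℝ := Complex.arg (p.snd / x) / (2 * Real.pi)
  liftedCircleAction b t (fibreMonodromy b β (liftedCircleAction b (-t) p))

/-- The flow `σ̃_B = σ_B × id` on `∂F × S¹ ⊆ ℂⁿ⁺¹ × ℂ`. -/
def productFlow {n : ℕ} (σ : AddCircle (1 : ℝ) → CSpace n → CSpace n) (t : AddCircle (1 : ℝ))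
    (p : CSpaceProd n) : CSpaceProd n :=
  WithLp.toLp 2 (σ t p.fst, p.snd)

end Milnor

end MilnorReeb

end

open MilnorReeb

/-! ### Tangent spaces -/

section TangentSpaces

variable {E F : Type*} [NormedAddCommGroup E] [NormedSpace ℝ E]
  [NormedAddCommGroup F] [NormedSpace ℝ F]

/-! The cutoff vanishes near `‖z‖ = 1`, so there every fibre coincides with `f = 0`, whatever `v`
is, and its boundary is the link `K` of the singularity, on which everything happens.
Quasihomogeneity spreads the isolatedness of the critical point over all of `ℂⁿ⁺¹`, since a critical
point off the origin would drag its whole dilation orbit along. Hence `K` is smooth in the unit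
sphere itself, for every `δ`.

Write `W` for the diagonal matrix of weights. The contact form is the standard form `Im ∑ z̄ᵢ dzᵢ`
divided by `h = 2π⟪z, Wz⟫`. The divisor is chosen so that the generator `B = 2πiWz` of the circle
action satisfies `η(B) = 1`. As `η` is invariant under that action, Cartan's formula suggests `dη(B,
·) = 0`, which `extDeriv_weightedContactForm_weightedReebField` confirms by computation. The
distribution `Θ = ker η` in `TK` is closed under multiplication by `i`, and `dη(v, iv) = 2‖v‖²/h`
there, so `dη` is nondegenerate on `Θ`.

The Euler field `Wz` is tangent to `f = 0` and satisfies `⟪z, Wz⟫ > 0`. It therefore supplies the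
direction of the fibre transverse to `K`, and it forces `N ≠ 0`; the splitting follows in
`boundary_splitting`.

The Reeb flow is the weighted circle action itself, whose orbits off the origin are circles. Since
`ρ_F` commutes with the lifted action up to the rotation of `v`, the conjugation defining the
monodromy cancels and leaves `σ(1/β) × id`, the Reeb flow at time `1/β`
(`coverMonodromy_eq_productFlow`). This map is a linear isometry preserving the boundary, hence
measure preserving, and its pullback is bounded on square integrable forms
(`exists_isPullbackOperator_isometry`). -/

theorem map_tangentCone_mem_of_mapsTo {g : E → F} {g' : E →L[ℝ] F} {S : Set E} {M : Set F} {a v : E}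
    (hg : HasFDerivWithinAt g g' S a) (hS : Set.MapsTo g S M) (hv : v ∈ tangentConeAt ℝ S a) :
    g' v ∈ tangentConeAt ℝ M (g a) :=
  tangentConeAt_mono hS.image_subset (hg.mapsTo_tangent_cone hv)

theorem tangentCone_singleton_subset (a : E) : tangentConeAt ℝ ({a} : Set E) a ⊆ {0} := by
  have := tangentConeAt_subset_zero (𝕜 := ℝ) (s := ({a} : Set E)) (x := a) (by
    rw [accPt_iff_clusterPt]
    intro h
    rw [ClusterPt, Filter.inf_principal] at h
    simp at h
    exact h.ne rfl)
  exact this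

theorem tangentSpaceAt_le_ker {g : E → F} {g' : E →L[ℝ] F} {M : Set E} {p : E} {U : Set E}
    (hU : U ∈ 𝓝 p) (hg : HasFDerivAt g g' p) (hM : ∀ q ∈ M ∩ U, g q = g p) :
    tangentSpaceAt M p ≤ g'.ker := by
  refine Submodule.span_le.2 fun w hw => ?_
  rw [← tangentConeAt_inter_nhds hU] at hw
  have := map_tangentCone_mem_of_mapsTo (M := {g p}) hg.hasFDerivWithinAt hM hw
  exact tangentCone_singleton_subset _ this

theorem tangentSpaceAt_mono_of_subset {M N : Set E} (h : M ⊆ N) (p : E) :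
    tangentSpaceAt M p ≤ tangentSpaceAt N p :=
  Submodule.span_mono (tangentConeAt_mono h)

/-- The parameter set `S` may be one-sided, as is needed at boundary points of a fibre: unique
differentiability makes the cone of `S` span `ℝ`, and the span is all that enters. -/
theorem deriv_mem_tangentSpaceAt {γ : ℝ → E} {w : E} {M : Set E} {S : Set ℝ} {t : ℝ}
    (hγ : HasDerivAt γ w t) (hS : Set.MapsTo γ S M) (ht : UniqueDiffWithinAt ℝ S t) :
    w ∈ tangentSpaceAt M (γ t) := by
  have h1 : (1 : ℝ) ∈ Submodule.span ℝ (tangentConeAt ℝ S t) := by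
    have h := ht.dense_tangentConeAt.closure_eq
    rw [((Submodule.span ℝ (tangentConeAt ℝ S t)).closed_of_finiteDimensional).closure_eq] at h
    exact (Set.ext_iff.1 h 1).2 (Set.mem_univ _)
  have h2 : Submodule.span ℝ (tangentConeAt ℝ S t) ≤
      (tangentSpaceAt M (γ t)).comap (ContinuousLinearMap.toSpanSingleton ℝ w).toLinearMap :=
    Submodule.span_le.2 fun v hv => Submodule.subset_span
      (map_tangentCone_mem_of_mapsTo hγ.hasFDerivAt.hasFDerivWithinAt hS hv)
  simpa using h2 h1

/-- The implicit function theorem produces, for each kernel vector, a curve in the level set with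
that velocity. -/
theorem tangentSpaceAt_eq_ker [FiniteDimensional ℝ E] [FiniteDimensional ℝ F]
    {g : E → F} {g' : E →L[ℝ] F} {M : Set E} {p : E} {U : Set E}
    (hU : U ∈ 𝓝 p) (hg : HasStrictFDerivAt g g' p) (hg' : g'.range = ⊤)
    (hM : ∀ q ∈ U, q ∈ M ↔ g q = g p) :
    tangentSpaceAt M p = g'.ker := by
  refine le_antisymm (tangentSpaceAt_le_ker hU hg.hasFDerivAt fun q hq => (hM q hq.2).1 hq.1) ?_
  intro w hw
  have : CompleteSpace E := FiniteDimensional.complete ℝ E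
  have : CompleteSpace F := FiniteDimensional.complete ℝ F
  have hd := (hg.to_implicitFunction hg').hasFDerivAt
  have h0 : hg.implicitFunction g g' hg' (g p) 0 = p := by
    simp
  set φ : ℝ → E := fun t => hg.implicitFunction g g' hg' (g p) (t • ⟨w, hw⟩) with hφ
  have hφ0 : φ 0 = p := by rw [hφ]; simpa only [zero_smul] using h0
  have hφd : HasDerivAt φ w 0 := by
    have h1 : HasDerivAt (fun t : ℝ => t • (⟨w, hw⟩ : g'.ker)) ⟨w, hw⟩ 0 := by
      simpa using (hasDerivAt_id (0 : ℝ)).smul_const (⟨w, hw⟩ : g'.ker)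
    have := HasFDerivAt.comp_hasDerivAt (𝕜 := ℝ) (0 : ℝ) (f := fun t : ℝ => t • (⟨w, hw⟩ : g'.ker))
      (by simpa using hd) h1
    simpa [hφ, Function.comp_def] using this
  have hmem : ∀ᶠ t in 𝓝 (0 : ℝ), φ t ∈ M := by
    have h1 : Filter.Tendsto (fun t : ℝ => (g p, t • (⟨w, hw⟩ : g'.ker))) (𝓝 0)
        (𝓝 (g p, 0)) := by
      have : Continuous (fun t : ℝ => (g p, t • (⟨w, hw⟩ : g'.ker))) := by fun_prop
      simpa using this.tendsto 0
    have h2 := h1.eventually (hg.map_implicitFunction_eq hg')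
    have h3 : ∀ᶠ t in 𝓝 (0 : ℝ), φ t ∈ U :=
      hφd.continuousAt.tendsto.eventually (by rw [hφ0]; exact hU)
    filter_upwards [h2, h3] with t h2 h3
    exact (hM _ h3).2 h2
  have := deriv_mem_tangentSpaceAt hφd (S := {t | φ t ∈ M}) (fun t ht => ht)
    (uniqueDiffWithinAt_of_mem_nhds hmem)
  rwa [hφ0] at this

end TangentSpaces

/-! ### Pullback of square integrable forms along linear isometries -/

section IsometryPullback

variable {E : Type*} [NormedAddCommGroup E] [InnerProductSpace ℝ E]

theorem tangentSpaceAt_map_isometry (Φ : E ≃ₗᵢ[ℝ] E) {M : Set E} (hM : ∀ p, Φ p ∈ M ↔ p ∈ M)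
    (p : E) : tangentSpaceAt M (Φ p) =
      (tangentSpaceAt M p).map (Φ.toLinearEquiv : E →ₗ[ℝ] E) := by
  apply le_antisymm
  · refine Submodule.span_le.2 fun w hw => ?_
    have hs : Set.MapsTo Φ.symm M M := fun q hq => by rw [← hM]; simpa using hq
    have := map_tangentCone_mem_of_mapsTo
      (Φ.symm.toContinuousLinearEquiv : E →L[ℝ] E).hasFDerivAt.hasFDerivWithinAt hs hw
    refine ⟨Φ.symm w, Submodule.subset_span (by simpa using this), by simp⟩
  · rw [Submodule.map_le_iff_le_comap]
    refine Submodule.span_le.2 fun w hw => Submodule.subset_span ?_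
    have hs : Set.MapsTo Φ M M := fun q hq => (hM q).2 hq
    exact map_tangentCone_mem_of_mapsTo
      (Φ.toContinuousLinearEquiv : E →L[ℝ] E).hasFDerivAt.hasFDerivWithinAt hs hw

theorem formPullback_comp (A C : E →L[ℝ] E) (α : ExteriorForms E) :
    formPullback (A.comp C) α = formPullback C (formPullback A α) := rfl

theorem measurePreserving_volumeOn [MeasurableSpace E] [BorelSpace E] (Φ : E ≃ₗᵢ[ℝ] E) {M : Set E}
    (hM : ∀ p, Φ p ∈ M ↔ p ∈ M) (d : ℕ) :
    MeasurePreserving Φ (volumeOn d M) (volumeOn d M) := by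
  have h := (Φ.toIsometryEquiv.measurePreserving_euclideanHausdorffMeasure d)
  have he : MeasurableEmbedding Φ := Φ.toHomeomorph.measurableEmbedding
  have := h.restrict_preimage_emb he M
  have hp : Φ.toIsometryEquiv ⁻¹' M = M := Set.ext hM
  rwa [hp] at this

variable [FiniteDimensional ℝ E]

theorem starProjection_tangentSpaceAt_isometry (Φ : E ≃ₗᵢ[ℝ] E) {M : Set E}
    (hM : ∀ p, Φ p ∈ M ↔ p ∈ M) (p w : E) :
    (tangentSpaceAt M (Φ p)).starProjection (Φ w) = Φ ((tangentSpaceAt M p).starProjection w) := by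
  have h := tangentSpaceAt_map_isometry Φ hM p
  apply Submodule.eq_starProjection_of_mem_of_inner_eq_zero
  · rw [h]
    exact ⟨_, Submodule.starProjection_apply_mem _ _, rfl⟩
  · rw [h]
    rintro _ ⟨y, hy, rfl⟩
    rw [← map_sub]
    exact (Φ.inner_map_map _ _).trans (Submodule.starProjection_inner_eq_zero w y hy)

theorem formCoord_injective : Function.Injective (formCoord E) := by
  rw [injective_iff_map_eq_zero]
  intro α hα
  funext k
  apply ContinuousAlternatingMap.toAlternatingMap_injective
  refine Module.Basis.ext_alternating (stdOrthonormalBasis ℝ E).toBasis fun v _ => ?_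
  have := congrArg (fun x => x ⟨k, v⟩) hα
  have hk : ((Real.sqrt (Nat.factorial k))⁻¹ : ℝ) ≠ 0 := by positivity
  simpa [formCoord, Nat.factorial_ne_zero] using this

/-- The pullback of forms along a fixed linear map, as a linear map. -/
noncomputable def formPullbackₗ (A : E →L[ℝ] E) : ExteriorForms E →ₗ[ℂ] ExteriorForms E where
  toFun := formPullback A
  map_add' α α' := by funext k; ext v; simp [formPullback]
  map_smul' c α := by funext k; ext v; simp [formPullback]

/-- The derivative of a linear map does not depend on the point, so a single matrix acts on
coefficient vectors everywhere. Coefficient vectors of forms are only a subspace, and a left inverse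
of `formCoord` extends the matrix to all vectors. -/
theorem exists_coord_formPullback (A : E →L[ℝ] E) :
    ∃ L : EuclideanSpace ℂ (FormIndex E) →L[ℂ] EuclideanSpace ℂ (FormIndex E),
      ∀ α, L (formCoord E α) = formCoord E (formPullback A α) := by
  obtain ⟨g, hg⟩ := (formCoord E).exists_leftInverse_of_injective
    (LinearMap.ker_eq_bot.2 formCoord_injective)
  refine ⟨LinearMap.toContinuousLinearMap (formCoord E ∘ₗ formPullbackₗ A ∘ₗ g), fun α => ?_⟩
  have : g (formCoord E α) = α := LinearMap.congr_fun hg α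
  simp [this, formPullbackₗ]

/-- An isometry preserving `M` intertwines the orthogonal projections onto the tangent spaces at `p`
and `Φ p`. For tangential forms the projection in `IsPullbackOperator` can therefore be dropped. -/
theorem formPullback_mem_tangentialForms (Φ : E ≃ₗᵢ[ℝ] E) {M : Set E}
    (hM : ∀ p, Φ p ∈ M ↔ p ∈ M) {p : E} {α : ExteriorForms E} (hα : α ∈ tangentialForms M (Φ p)) :
    formPullback (Φ.toContinuousLinearEquiv : E →L[ℝ] E) α ∈ tangentialForms M p ∧
    formPullback ((Φ.toContinuousLinearEquiv : E →L[ℝ] E).comp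
      (tangentSpaceAt M p).starProjection) α =
      formPullback (Φ.toContinuousLinearEquiv : E →L[ℝ] E) α := by
  have hα' : formPullback (tangentSpaceAt M (Φ p)).starProjection α = α := hα
  have hc : (Φ.toContinuousLinearEquiv : E →L[ℝ] E).comp (tangentSpaceAt M p).starProjection =
      (tangentSpaceAt M (Φ p)).starProjection.comp (Φ.toContinuousLinearEquiv : E →L[ℝ] E) := by
    ext w
    exact (starProjection_tangentSpaceAt_isometry Φ hM p w).symm
  have h2 : formPullback ((Φ.toContinuousLinearEquiv : E →L[ℝ] E).comp
      (tangentSpaceAt M p).starProjection) α =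
      formPullback (Φ.toContinuousLinearEquiv : E →L[ℝ] E) α := by
    rw [hc, formPullback_comp, hα']
  exact ⟨h2, h2⟩

/-- The derivative within `M` is determined only on the span of the tangent cone; composing with the
projection removes the ambiguity. -/
theorem fderivWithin_comp_starProjection (Φ : E ≃ₗᵢ[ℝ] E) (M : Set E) (p : E) :
    (fderivWithin ℝ Φ M p).comp (tangentSpaceAt M p).starProjection =
      (Φ.toContinuousLinearEquiv : E →L[ℝ] E).comp (tangentSpaceAt M p).starProjection := by
  have hd : HasFDerivWithinAt Φ (Φ.toContinuousLinearEquiv : E →L[ℝ] E) M p :=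
    (Φ.toContinuousLinearEquiv : E →L[ℝ] E).hasFDerivAt.hasFDerivWithinAt
  have h := hd.differentiableWithinAt.hasFDerivWithinAt.unique_on hd
  ext w
  have hspan : Set.EqOn (fderivWithin ℝ Φ M p)
      (Φ.toContinuousLinearEquiv : E →L[ℝ] E) (tangentSpaceAt M p) :=
    LinearMap.eqOn_span (f := (fderivWithin ℝ Φ M p).toLinearMap)
      (g := ((Φ.toContinuousLinearEquiv : E →L[ℝ] E)).toLinearMap) h
  exact hspan (Submodule.starProjection_apply_mem _ w)

variable [MeasurableSpace E] [BorelSpace E]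

/-- A linear isometry preserving `M` acts by pullback as a bounded operator on the square
integrable forms on `M`. -/
theorem exists_isPullbackOperator_isometry (Φ : E ≃ₗᵢ[ℝ] E) {M : Set E}
    (hM : ∀ p, Φ p ∈ M ↔ p ∈ M) (d : ℕ) :
    ∃ T : L2Forms d M →L[ℂ] L2Forms d M, IsPullbackOperator Φ T := by
  obtain ⟨L, hL⟩ := exists_coord_formPullback (Φ.toContinuousLinearEquiv : E →L[ℝ] E)
  have hmp := measurePreserving_volumeOn Φ hM d
  let S : Lp (EuclideanSpace ℂ (FormIndex E)) 2 (volumeOn d M) →L[ℂ]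
      Lp (EuclideanSpace ℂ (FormIndex E)) 2 (volumeOn d M) :=
    (L.compLpL 2 (volumeOn d M)).comp
      (Lp.compMeasurePreservingₗᵢ ℂ Φ hmp).toContinuousLinearMap
  have hS : ∀ u, ∀ᵐ p ∂(volumeOn d M), S u p = L (u (Φ p)) := by
    intro u
    filter_upwards [L.coeFn_compLp (Lp.compMeasurePreservingₗᵢ ℂ Φ hmp u),
      Lp.coeFn_compMeasurePreserving u hmp] with p h1 h2
    refine h1.trans ?_
    congr 1
  have hmaps : ∀ u ∈ L2Forms d M, S u ∈ L2Forms d M := by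
    intro u hu
    -- Preservation of the measure turns a property of almost every `p` into the same property of `Φ
    -- p` for almost every `p`.
    have hu' := hmp.quasiMeasurePreserving.ae hu
    filter_upwards [hS u, hu'] with p h1 h2
    obtain ⟨α, hα, hα'⟩ := h2
    rw [h1, ← hα', hL]
    exact ⟨_, (formPullback_mem_tangentialForms Φ hM hα).1, rfl⟩
  refine ⟨S.restrict hmaps, fun p hp => (hM p).2 hp,
    (Φ.toContinuousLinearEquiv : E →L[ℝ] E).differentiable.differentiableOn, ?_⟩
  intro α u hu
  have hu' := hmp.quasiMeasurePreserving.ae hu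
  filter_upwards [hS u, hu'] with p h1 h2
  obtain ⟨hα, h2⟩ := h2
  have h3 := formPullback_mem_tangentialForms Φ hM hα
  rw [fderivWithin_comp_starProjection, h3.2]
  refine ⟨h3.1, ?_⟩
  rw [← hL, ← h2]
  exact h1

end IsometryPullback

/-! ### One-forms -/

section OneForms

variable {E : Type*} [NormedAddCommGroup E] [NormedSpace ℝ E]

/-- The one-form `c • A`, where `A` depends linearly on the base point. -/
noncomputable def scaledOneForm (c : E → ℝ) (A : E →L[ℝ] E →L[ℝ] ℝ) (p : E) : E [⋀^Fin 1]→L[ℝ] ℝ :=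
  c p • (ContinuousAlternatingMap.ofSubsingletonLIE (𝕜 := ℝ) (E := E) (F := ℝ) (0 : Fin 1)) (A p)

theorem scaledOneForm_apply (c : E → ℝ) (A : E →L[ℝ] E →L[ℝ] ℝ) (p v : E) :
    scaledOneForm c A p ![v] = c p * A p v := by
  simp [scaledOneForm]

theorem contDiffOn_scaledOneForm {c : E → ℝ} {U : Set E} (hc : ContDiffOn ℝ ∞ c U)
    (A : E →L[ℝ] E →L[ℝ] ℝ) : ContDiffOn ℝ ∞ (scaledOneForm c A) U := by
  refine hc.smul (ContDiff.contDiffOn ?_)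
  exact (ContinuousAlternatingMap.ofSubsingletonLIE (𝕜 := ℝ) (E := E) (F := ℝ)
    (0 : Fin 1)).contDiff.comp A.contDiff

/-- This is `d(cA) = dc ∧ A + c dA`, where linearity of `A` in the base point gives `dA(v, w) = A v
w - A w v`. -/
theorem extDeriv_scaledOneForm {c : E → ℝ} {c' : E →L[ℝ] ℝ} {p : E} (hc : HasFDerivAt c c' p)
    (A : E →L[ℝ] E →L[ℝ] ℝ) (v w : E) :
    extDeriv (scaledOneForm c A) p ![v, w] =
      c' v * A p w - c' w * A p v + c p * (A v w - A w v) := by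
  have h := hc.smul ((ContinuousAlternatingMap.ofSubsingletonLIE (𝕜 := ℝ) (E := E) (F := ℝ)
    (0 : Fin 1)).toContinuousLinearEquiv.toContinuousLinearMap.comp A).hasFDerivAt
  have h' : HasFDerivAt (scaledOneForm c A) _ p := h
  have e1 : Fin.removeNth (0 : Fin 2) ![v, w] = ![w] := by ext i; fin_cases i; rfl
  have e2 : Fin.removeNth (1 : Fin 2) ![v, w] = ![v] := by ext i; fin_cases i; rfl
  rw [extDeriv, h'.fderiv, ContinuousAlternatingMap.alternatizeUncurryFin_apply, Fin.sum_univ_two,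
    e1, e2]
  simp
  ring

end OneForms

/-! ### Diagonal maps of `ℂⁿ⁺¹` -/

section Diagonal

variable {n : ℕ}

/-- The diagonal map with the entries `c`. -/
noncomputable def diagMap (c : Fin (n + 1) → ℂ) : CSpace n →L[ℝ] CSpace n :=
  LinearMap.toContinuousLinearMap
    { toFun z := WithLp.toLp 2 fun i => c i * z i
      map_add' z w := by ext i; simp [mul_add]
      map_smul' r z := by ext i; simp [mul_left_comm] }

@[simp] theorem diagMap_apply (c : Fin (n + 1) → ℂ) (z : CSpace n) (i : Fin (n + 1)) :
    diagMap c z i = c i * z i := rfl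

theorem diagMap_diagMap (c d : Fin (n + 1) → ℂ) (z : CSpace n) :
    diagMap c (diagMap d z) = diagMap (fun i => c i * d i) z := by
  ext i; simp [mul_assoc]

theorem inner_eq_sum_re (z w : CSpace n) :
    ⟪z, w⟫ = ∑ i, (z i * (starRingEnd ℂ) (w i)).re := by
  rw [PiLp.inner_apply]
  refine Finset.sum_congr rfl fun i _ => ?_
  rw [Complex.inner]
  simp
  ring

theorem inner_diagMap_left (c : Fin (n + 1) → ℂ) (z w : CSpace n) :
    ⟪diagMap c z, w⟫ = ⟪z, diagMap (fun i => (starRingEnd ℂ) (c i)) w⟫ := by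
  simp only [inner_eq_sum_re, diagMap_apply, map_mul, Complex.conj_conj]
  refine Finset.sum_congr rfl fun i _ => ?_
  ring_nf

theorem norm_diagMap {c : Fin (n + 1) → ℂ} (hc : ∀ i, ‖c i‖ = 1) (z : CSpace n) :
    ‖diagMap c z‖ = ‖z‖ := by
  simp [EuclideanSpace.norm_eq, hc]

/-- Multiplication by the imaginary unit. -/
noncomputable abbrev imagMap (n : ℕ) : CSpace n →L[ℝ] CSpace n := diagMap fun _ => Complex.I

/-- The diagonal map with the weights as its entries. -/
noncomputable abbrev weightMap (b : Fin (n + 1) → ℕ) : CSpace n →L[ℝ] CSpace n :=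
  diagMap fun i => (b i : ℂ)

theorem imagMap_imagMap (z : CSpace n) : imagMap n (imagMap n z) = -z := by
  ext i; simp [← mul_assoc]

theorem weightMap_imagMap (b : Fin (n + 1) → ℕ) (z : CSpace n) :
    weightMap b (imagMap n z) = imagMap n (weightMap b z) := by
  ext i; simp [mul_left_comm]

theorem inner_imagMap_left (z w : CSpace n) : ⟪imagMap n z, w⟫ = -⟪z, imagMap n w⟫ := by
  rw [inner_diagMap_left, ← inner_neg_right]
  congr 1
  ext i; simp

theorem inner_imagMap_self (z : CSpace n) : ⟪imagMap n z, z⟫ = 0 := by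
  have := inner_imagMap_left z z
  rw [real_inner_comm z] at this
  linarith [real_inner_comm z (imagMap n z)]

theorem inner_weightMap_left (b : Fin (n + 1) → ℕ) (z w : CSpace n) :
    ⟪weightMap b z, w⟫ = ⟪z, weightMap b w⟫ := by
  rw [inner_diagMap_left]; simp

theorem inner_weightMap_self_pos {b : Fin (n + 1) → ℕ} (hb : ∀ i, 0 < b i) {z : CSpace n}
    (hz : z ≠ 0) : 0 < ⟪z, weightMap b z⟫ := by
  have h : ∀ i, (z i * (starRingEnd ℂ) (weightMap b z i)).re = b i * ‖z i‖ ^ 2 := by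
    intro i
    rw [← Complex.normSq_eq_norm_sq, Complex.normSq_apply]
    simp
    ring
  rw [inner_eq_sum_re]
  simp only [h]
  obtain ⟨i, hi⟩ : ∃ i, z i ≠ 0 := by
    by_contra! h0
    exact hz (by ext i; simpa using h0 i)
  refine Finset.sum_pos' (fun j _ => by positivity) ⟨i, Finset.mem_univ _, ?_⟩
  have := hb i
  have := norm_pos_iff.2 hi
  positivity

end Diagonal

/-! ### The weighted contact form -/

section ContactForm

variable {n : ℕ}

/-- The quadratic function `2π ∑ bᵢ |zᵢ|²`. -/
noncomputable def weightedSquare (b : Fin (n + 1) → ℕ) (z : CSpace n) : ℝ :=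
  2 * Real.pi * ⟪z, weightMap b z⟫

/-- The one-form `Im ∑ z̄ᵢ dzᵢ / (2π ∑ bᵢ |zᵢ|²)`. -/
noncomputable def weightedContactForm (b : Fin (n + 1) → ℕ) :
    CSpace n → CSpace n [⋀^Fin 1]→L[ℝ] ℝ :=
  scaledOneForm (fun z => (weightedSquare b z)⁻¹) ((innerSL ℝ).comp (imagMap n))

/-- The generator of the weighted circle action. -/
noncomputable def weightedReebField (b : Fin (n + 1) → ℕ) (z : CSpace n) : CSpace n :=
  (2 * Real.pi) • imagMap n (weightMap b z)

theorem weightedContactForm_apply (b : Fin (n + 1) → ℕ) (z v : CSpace n) :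
    weightedContactForm b z ![v] = (weightedSquare b z)⁻¹ * ⟪imagMap n z, v⟫ := by
  simp [weightedContactForm, scaledOneForm_apply]

theorem weightedSquare_pos {b : Fin (n + 1) → ℕ} (hb : ∀ i, 0 < b i) {z : CSpace n}
    (hz : z ≠ 0) : 0 < weightedSquare b z :=
  mul_pos Real.two_pi_pos (inner_weightMap_self_pos hb hz)

theorem contDiff_weightedSquare (b : Fin (n + 1) → ℕ) : ContDiff ℝ ∞ (weightedSquare b) :=
  contDiff_const.mul (contDiff_id.inner ℝ (weightMap b).contDiff)

theorem contDiffOn_weightedContactForm {b : Fin (n + 1) → ℕ} (hb : ∀ i, 0 < b i) :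
    ContDiffOn ℝ ∞ (weightedContactForm b) {0}ᶜ :=
  contDiffOn_scaledOneForm ((contDiff_weightedSquare b).contDiffOn.inv
    fun _ hz => (weightedSquare_pos hb hz).ne') _

theorem weightedContactForm_weightedReebField {b : Fin (n + 1) → ℕ} (hb : ∀ i, 0 < b i)
    {z : CSpace n} (hz : z ≠ 0) : weightedContactForm b z ![weightedReebField b z] = 1 := by
  have h := weightedSquare_pos hb hz
  rw [weightedContactForm_apply, weightedReebField, inner_smul_right, inner_imagMap_left,
    imagMap_imagMap, inner_neg_right, neg_neg]
  exact inv_mul_cancel₀ h.ne'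

/-- The derivative of `1/h` is `-dh/h²` with `dh = 4π⟪Wz, ·⟫`. One factor `1/h` is absorbed into
`η`, so that the correction terms visibly vanish on `ker η`. -/
theorem extDeriv_weightedContactForm {b : Fin (n + 1) → ℕ} (hb : ∀ i, 0 < b i)
    {z : CSpace n} (hz : z ≠ 0) (v w : CSpace n) :
    extDeriv (weightedContactForm b) z ![v, w] =
      (weightedSquare b z)⁻¹ * (2 * ⟪imagMap n v, w⟫ -
        4 * Real.pi * (⟪weightMap b z, v⟫ * weightedContactForm b z ![w] -
          ⟪weightMap b z, w⟫ * weightedContactForm b z ![v])) := by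
  have hpos := weightedSquare_pos hb hz
  have h1 : HasFDerivAt (weightedSquare b) _ z :=
    ((hasFDerivAt_id z).inner ℝ (weightMap b).hasFDerivAt).const_mul (2 * Real.pi)
  have h2 : HasFDerivAt (fun z => (weightedSquare b z)⁻¹) _ z :=
    (hasDerivAt_inv hpos.ne').comp_hasFDerivAt z h1
  rw [weightedContactForm_apply, weightedContactForm_apply, weightedContactForm,
    extDeriv_scaledOneForm h2]
  have e : ∀ u, ⟪z, weightMap b u⟫ = ⟪weightMap b z, u⟫ := fun u => (inner_weightMap_left b z u).symm
  have e2 : ⟪imagMap n w, v⟫ = - ⟪imagMap n v, w⟫ := by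
    rw [inner_imagMap_left, real_inner_comm]
  have e3 : ∀ u, ⟪u, weightMap b z⟫ = ⟪weightMap b z, u⟫ := fun u => real_inner_comm _ _
  simp [e, e2, e3]
  field_simp
  ring

/-- The term `2⟪iB, w⟫ = -4π⟪Wz, w⟫` cancels against the correction from `dh`, because `η(B) = 1`
and `⟪Wz, B⟫ = 0`. No tangency of `w` is needed. -/
theorem extDeriv_weightedContactForm_weightedReebField {b : Fin (n + 1) → ℕ} (hb : ∀ i, 0 < b i)
    {z : CSpace n} (hz : z ≠ 0) (w : CSpace n) :
    extDeriv (weightedContactForm b) z ![weightedReebField b z, w] = 0 := by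
  rw [extDeriv_weightedContactForm hb hz, weightedContactForm_weightedReebField hb hz,
    weightedReebField, map_smul, imagMap_imagMap, inner_smul_left, inner_smul_right,
    inner_neg_left, real_inner_comm (imagMap n (weightMap b z)) (weightMap b z),
    inner_imagMap_self]
  simp
  right
  ring

theorem extDeriv_weightedContactForm_imagMap_ne_zero {b : Fin (n + 1) → ℕ} (hb : ∀ i, 0 < b i)
    {z : CSpace n} (hz : z ≠ 0) {v : CSpace n} (hv : v ≠ 0)
    (h1 : weightedContactForm b z ![v] = 0) (h2 : weightedContactForm b z ![imagMap n v] = 0) :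
    extDeriv (weightedContactForm b) z ![v, imagMap n v] ≠ 0 := by
  rw [extDeriv_weightedContactForm hb hz, h1, h2, inner_imagMap_left, imagMap_imagMap]
  have := weightedSquare_pos hb hz
  simp [this.ne', hv]

end ContactForm

/-! ### Polynomial functions on `ℂⁿ⁺¹` -/

section Polynomials

variable {n : ℕ}

/-- The polynomial function of `f` on `ℂⁿ⁺¹`. -/
noncomputable def polyFun (f : MvPolynomial (Fin (n + 1)) ℂ) (z : CSpace n) : ℂ :=
  MvPolynomial.eval (fun i => z i) f

/-- The differential of the polynomial function of `f`. -/
noncomputable def polyDeriv (f : MvPolynomial (Fin (n + 1)) ℂ) (z : CSpace n) : CSpace n →L[ℝ] ℂ :=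
  ∑ i, polyFun (MvPolynomial.pderiv i f) z • PiLp.proj (𝕜 := ℝ) 2 (fun _ : Fin (n + 1) => ℂ) i

theorem polyDeriv_apply (f : MvPolynomial (Fin (n + 1)) ℂ) (z w : CSpace n) :
    polyDeriv f z w = ∑ i, polyFun (MvPolynomial.pderiv i f) z * w i := by
  simp [polyDeriv]

theorem hasStrictFDerivAt_polyFun (f : MvPolynomial (Fin (n + 1)) ℂ) (z : CSpace n) :
    HasStrictFDerivAt (polyFun f) (polyDeriv f z) z := by
  induction f using MvPolynomial.induction_on with
  | C a =>
    have h : polyFun (MvPolynomial.C a) = fun _ : CSpace n => a := by ext w; simp [polyFun]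
    rw [h]
    refine (hasStrictFDerivAt_const a z).congr_fderiv ?_
    ext w; simp [polyDeriv, polyFun]
  | add p q hp hq =>
    have h : polyFun (p + q) = fun w : CSpace n => polyFun p w + polyFun q w := by
      ext w; simp [polyFun]
    rw [h]
    refine (hp.add hq).congr_fderiv ?_
    ext w; simp [polyDeriv_apply, polyFun, add_mul, Finset.sum_add_distrib]
  | mul_X p j hp =>
    have h : polyFun (p * MvPolynomial.X j) = fun w : CSpace n => polyFun p w * w j := by
      ext w; simp [polyFun]
    rw [h]
    refine (hp.mul (PiLp.proj (𝕜 := ℝ) 2 (fun _ : Fin (n + 1) => ℂ) j).hasStrictFDerivAt).congr_fderiv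
      ?_
    ext w
    simp [polyDeriv_apply, polyFun, MvPolynomial.pderiv_X, Pi.single_apply, add_mul,
      Finset.sum_add_distrib, Finset.mul_sum, apply_ite]
    refine Finset.sum_congr rfl fun i _ => by ring

theorem contDiff_polyFun (f : MvPolynomial (Fin (n + 1)) ℂ) : ContDiff ℝ ∞ (polyFun f) := by
  induction f using MvPolynomial.induction_on with
  | C a =>
    have h : polyFun (MvPolynomial.C a) = fun _ : CSpace n => a := by ext w; simp [polyFun]
    exact h ▸ contDiff_const
  | add p q hp hq =>
    have h : polyFun (p + q) = fun w : CSpace n => polyFun p w + polyFun q w := by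
      ext w; simp [polyFun]
    exact h ▸ hp.add hq
  | mul_X p j hp =>
    have h : polyFun (p * MvPolynomial.X j) = fun w : CSpace n => polyFun p w * w j := by
      ext w; simp [polyFun]
    exact h ▸ hp.mul (PiLp.proj (𝕜 := ℝ) 2 (fun _ : Fin (n + 1) => ℂ) j).contDiff

theorem polyDeriv_imagMap (f : MvPolynomial (Fin (n + 1)) ℂ) (z w : CSpace n) :
    polyDeriv f z (imagMap n w) = Complex.I * polyDeriv f z w := by
  simp only [polyDeriv_apply, diagMap_apply, Finset.mul_sum]
  exact Finset.sum_congr rfl fun i _ => by ring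

theorem polyDeriv_single (f : MvPolynomial (Fin (n + 1)) ℂ) (z : CSpace n) (i : Fin (n + 1))
    (c : ℂ) : polyDeriv f z (EuclideanSpace.single i c) =
      polyFun (MvPolynomial.pderiv i f) z * c := by
  simp [polyDeriv_apply]

end Polynomials

/-! ### Quasihomogeneous polynomials -/

section Quasihomogeneous

variable {n : ℕ} {f : MvPolynomial (Fin (n + 1)) ℂ} {b : Fin (n + 1) → ℕ} {β : ℕ}

theorem MilnorReeb.IsQuasihomogeneous.polyFun_diagMap (hf : IsQuasihomogeneous f b β) {t : ℂ}
    (ht : t ≠ 0) (z : CSpace n) :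
    polyFun f (diagMap (fun i => t ^ b i) z) = t ^ β * polyFun f z :=
  hf.2.2 t ht _

theorem MilnorReeb.IsQuasihomogeneous.polyDeriv_diagMap (hf : IsQuasihomogeneous f b β) {t : ℂ}
    (ht : t ≠ 0) (z w : CSpace n) :
    polyDeriv f (diagMap (fun i => t ^ b i) z) (diagMap (fun i => t ^ b i) w) =
      t ^ β * polyDeriv f z w := by
  have h1 := (hasStrictFDerivAt_polyFun f (diagMap (fun i => t ^ b i) z)).hasFDerivAt.comp z
    (diagMap (fun i => t ^ b i)).hasFDerivAt
  have h2 := (hasStrictFDerivAt_polyFun f z).hasFDerivAt.const_mul (t ^ β)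
  have h : polyFun f ∘ diagMap (fun i => t ^ b i) = fun z => t ^ β * polyFun f z :=
    funext (hf.polyFun_diagMap ht)
  rw [h] at h1
  exact congrArg (fun L : CSpace n →L[ℝ] ℂ => L w) (h1.unique h2)

theorem hasDerivAt_of_coord {γ : ℝ → CSpace n} {w : CSpace n} {t : ℝ}
    (h : ∀ i, HasDerivAt (fun s => γ s i) (w i) t) : HasDerivAt γ w t := by
  rw [hasDerivAt_iff_hasFDerivAt, ← hasFDerivWithinAt_univ, hasFDerivWithinAt_piLp]
  intro i
  rw [hasFDerivWithinAt_univ]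
  refine (h i).hasFDerivAt.congr_fderiv ?_
  ext; simp

/-- The orbit of `z` under the real one-parameter group of dilations. -/
noncomputable def dilationCurve (b : Fin (n + 1) → ℕ) (z : CSpace n) (s : ℝ) : CSpace n :=
  diagMap (fun i => (Real.exp s : ℂ) ^ b i) z

theorem hasDerivAt_dilationCurve (b : Fin (n + 1) → ℕ) (z : CSpace n) :
    HasDerivAt (dilationCurve b z) (weightMap b z) 0 := by
  refine hasDerivAt_of_coord fun i => ?_
  have h : HasDerivAt (fun s : ℝ => (Real.exp s : ℂ)) (1 : ℂ) 0 := by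
    simpa using (Real.hasDerivAt_exp 0).ofReal_comp
  simpa [dilationCurve] using (h.pow (b i)).mul_const (z i)

theorem dilationCurve_zero (b : Fin (n + 1) → ℕ) (z : CSpace n) : dilationCurve b z 0 = z := by
  ext i; simp [dilationCurve]

theorem MilnorReeb.IsQuasihomogeneous.polyFun_dilationCurve (hf : IsQuasihomogeneous f b β)
    {z : CSpace n} (hz : polyFun f z = 0) (s : ℝ) : polyFun f (dilationCurve b z s) = 0 := by
  rw [dilationCurve, hf.polyFun_diagMap (by exact_mod_cast (Real.exp_pos s).ne'), hz, mul_zero]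

theorem norm_dilationCurve_le (b : Fin (n + 1) → ℕ) (z : CSpace n) {s : ℝ} (hs : s ≤ 0) :
    ‖dilationCurve b z s‖ ≤ ‖z‖ := by
  rw [EuclideanSpace.norm_eq, EuclideanSpace.norm_eq]
  refine Real.sqrt_le_sqrt (Finset.sum_le_sum fun i _ => ?_)
  rw [dilationCurve, diagMap_apply, norm_mul, norm_pow, Complex.norm_real, Real.norm_eq_abs,
    abs_of_pos (Real.exp_pos s)]
  have h := pow_le_one₀ (n := b i) (Real.exp_pos s).le (Real.exp_le_one_iff.2 hs)
  gcongr
  exact mul_le_of_le_one_left (norm_nonneg _) h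

/-- Euler's identity on the zero set: real dilations preserve `f = 0`, and `Wz` is their velocity.
-/
theorem MilnorReeb.IsQuasihomogeneous.polyDeriv_weightMap (hf : IsQuasihomogeneous f b β)
    {z : CSpace n} (hz : polyFun f z = 0) : polyDeriv f z (weightMap b z) = 0 := by
  have h := (hasStrictFDerivAt_polyFun f (dilationCurve b z 0)).hasFDerivAt.comp_hasDerivAt 0
    (hasDerivAt_dilationCurve b z)
  have h0 : polyFun f ∘ dilationCurve b z = fun _ => 0 := funext (hf.polyFun_dilationCurve hz)
  rw [h0, dilationCurve_zero] at h
  exact h.unique (hasDerivAt_const 0 0)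

/-- The dilations carry critical points to critical points, so one off the origin would yield others
arbitrarily close to the origin. -/
theorem MilnorReeb.IsQuasihomogeneous.exists_pderiv_ne_zero (hf : IsQuasihomogeneous f b β)
    (hsing : HasIsolatedSingularity f) {z : CSpace n} (hz : z ≠ 0) :
    ∃ i, polyFun (MvPolynomial.pderiv i f) z ≠ 0 := by
  by_contra! hcrit
  have hlim : Filter.Tendsto (fun t : ℝ => fun i => (t : ℂ) ^ b i * z i) (𝓝[>] 0)
      (𝓝[≠] (0 : Fin (n + 1) → ℂ)) := by
    rw [tendsto_nhdsWithin_iff]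
    constructor
    · have hc : Continuous (fun t : ℝ => fun i => (t : ℂ) ^ b i * z i) := by fun_prop
      have := hc.tendsto 0
      have h0 : (fun i => ((0 : ℝ) : ℂ) ^ b i * z i) = 0 := by
        ext i; simp [(hf.1 i).ne']
      rw [h0] at this
      exact this.mono_left nhdsWithin_le_nhds
    · filter_upwards [self_mem_nhdsWithin] with t ht h0
      refine hz ?_
      ext i
      have := congrFun h0 i
      simpa [(ne_of_gt ht : t ≠ 0)] using this
  obtain ⟨t, ⟨i, hi⟩, ht⟩ := ((hlim.eventually hsing.2).and self_mem_nhdsWithin).exists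
  have ht0 : (t : ℂ) ≠ 0 := by exact_mod_cast (ne_of_gt ht : t ≠ 0)
  -- In coordinates: `t ^ bᵢ ∂ᵢf(t·z) = t ^ β ∂ᵢf(z)`, so a zero of `∂ᵢf` at `z` is one at `t·z`.
  have h := hf.polyDeriv_diagMap ht0 z (EuclideanSpace.single i 1)
  have hs : diagMap (fun i => (t : ℂ) ^ b i) (EuclideanSpace.single i 1) =
      EuclideanSpace.single i ((t : ℂ) ^ b i) := by
    ext j
    by_cases hj : j = i
    · subst hj; simp
    · simp [hj]
  rw [hs, polyDeriv_single, polyDeriv_single, hcrit i] at h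
  simp only [zero_mul, mul_zero, mul_eq_zero, pow_eq_zero_iff', ht0, false_and, or_false] at h
  exact hi h

end Quasihomogeneous

/-! ### The link of the singularity -/

section Link

variable {n : ℕ} {f : MvPolynomial (Fin (n + 1)) ℂ} {b : Fin (n + 1) → ℕ} {β : ℕ}

/-- The link of the origin in the zero set of `f`. -/
def singularityLink (f : MvPolynomial (Fin (n + 1)) ℂ) : Set (CSpace n) :=
  {z | ‖z‖ = 1 ∧ polyFun f z = 0}

theorem ne_zero_of_mem_singularityLink {z : CSpace n} (hz : z ∈ singularityLink f) : z ≠ 0 :=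
  norm_pos_iff.1 (hz.1 ▸ one_pos)

/-- The defining map of the link. -/
noncomputable def linkMap (f : MvPolynomial (Fin (n + 1)) ℂ) (z : CSpace n) : ℂ × ℝ :=
  (polyFun f z, ‖z‖ ^ 2 - 1)

/-- The differential of the defining map of the link. -/
noncomputable def linkDeriv (f : MvPolynomial (Fin (n + 1)) ℂ) (z : CSpace n) :
    CSpace n →L[ℝ] ℂ × ℝ :=
  (polyDeriv f z).prod (2 • innerSL ℝ z)

theorem hasStrictFDerivAt_linkMap (f : MvPolynomial (Fin (n + 1)) ℂ) (z : CSpace n) :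
    HasStrictFDerivAt (linkMap f) (linkDeriv f z) z :=
  (hasStrictFDerivAt_polyFun f z).prodMk ((hasStrictFDerivAt_norm_sq z).sub_const 1)

theorem contDiff_linkMap (f : MvPolynomial (Fin (n + 1)) ℂ) : ContDiff ℝ ∞ (linkMap f) :=
  (contDiff_polyFun f).prodMk ((contDiff_norm_sq ℝ).sub contDiff_const)

theorem mem_singularityLink_iff_linkMap {z : CSpace n} :
    z ∈ singularityLink f ↔ linkMap f z = 0 := by
  rw [linkMap, Prod.mk_eq_zero, sub_eq_zero, pow_eq_one_iff_of_nonneg (norm_nonneg z) two_ne_zero, and_comm]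
  rfl

theorem mem_ker_linkDeriv {z w : CSpace n} :
    w ∈ (linkDeriv f z).ker ↔ polyDeriv f z w = 0 ∧ ⟪z, w⟫ = 0 := by
  simp [linkDeriv]

theorem linkDeriv_surjective (hf : IsQuasihomogeneous f b β) (hsing : HasIsolatedSingularity f)
    {z : CSpace n} (hz : z ∈ singularityLink f) : Function.Surjective (linkDeriv f z) := by
  have hz0 := ne_zero_of_mem_singularityLink hz
  obtain ⟨i, hi⟩ := hf.exists_pderiv_ne_zero hsing hz0
  have hpos := (inner_weightMap_self_pos hf.1 hz0).ne'
  rintro ⟨c, r⟩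
  set u : CSpace n := EuclideanSpace.single i (c / polyFun (MvPolynomial.pderiv i f) z)
  have hu : polyDeriv f z u = c := by
    rw [polyDeriv_single, mul_div_cancel₀ _ hi]
  -- The vector `u` hits the value in `ℂ`. A multiple of the Euler field then corrects the radial
  -- component without changing it; `r / 2` appears because `‖z‖²` has derivative `2⟪z, ·⟫`.
  refine ⟨u + ((r / 2 - ⟪z, u⟫) / ⟪z, weightMap b z⟫) • weightMap b z, Prod.ext ?_ ?_⟩
  · simp [linkDeriv, hu, hf.polyDeriv_weightMap hz.2]
  · simp only [linkDeriv, ContinuousLinearMap.prod_apply, smul_apply,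
      innerSL_apply_apply, inner_add_right, inner_smul_right, div_mul_cancel₀ _ hpos]
    simp [mul_div_cancel₀]

theorem isSmoothSubmanifold_singularityLink (hn : 1 ≤ n) (hf : IsQuasihomogeneous f b β)
    (hsing : HasIsolatedSingularity f) : IsSmoothSubmanifold (2 * n - 1) (singularityLink f) := by
  intro p hp
  have hfin : Module.finrank ℝ (ℂ × ℝ) = Module.finrank ℝ (Fin 3 → ℝ) := by simp
  let Λ := ContinuousLinearEquiv.ofFinrankEq hfin
  have hE : Module.finrank ℝ (CSpace n) = 2 * (n + 1) := by
    rw [← Module.finrank_mul_finrank ℝ ℂ (CSpace n)]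
    simp
  -- The real codimension is `3 = dim (ℂ × ℝ)`; `hn` makes the truncated `2 * n - 1` correct.
  refine ⟨3, Set.univ, fun z => Λ (linkMap f z), by omega, isOpen_univ, Set.mem_univ _,
    (Λ.contDiff.comp (contDiff_linkMap f)).contDiffOn, ?_, ?_⟩
  · have h := Λ.hasFDerivAt.comp p (hasStrictFDerivAt_linkMap f p).hasFDerivAt
    have h' : HasFDerivAt (fun z => Λ (linkMap f z)) _ p := h
    rw [h'.fderiv]
    exact Λ.surjective.comp (linkDeriv_surjective hf hsing hp)
  · ext z
    simp [mem_singularityLink_iff_linkMap]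

theorem mem_tangentSpaceAt_singularityLink (hf : IsQuasihomogeneous f b β)
    (hsing : HasIsolatedSingularity f) {z w : CSpace n} (hz : z ∈ singularityLink f) :
    w ∈ tangentSpaceAt (singularityLink f) z ↔ polyDeriv f z w = 0 ∧ ⟪z, w⟫ = 0 := by
  rw [tangentSpaceAt_eq_ker (Filter.univ_mem : Set.univ ∈ 𝓝 z) (hasStrictFDerivAt_linkMap f z)
    (LinearMap.range_eq_top.2 (linkDeriv_surjective hf hsing hz)), mem_ker_linkDeriv]
  intro q _
  rw [mem_singularityLink_iff_linkMap, mem_singularityLink_iff_linkMap.1 hz]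

theorem weightedReebField_mem_tangentSpaceAt (hf : IsQuasihomogeneous f b β)
    (hsing : HasIsolatedSingularity f) {z : CSpace n} (hz : z ∈ singularityLink f) :
    weightedReebField b z ∈ tangentSpaceAt (singularityLink f) z := by
  rw [mem_tangentSpaceAt_singularityLink hf hsing hz, weightedReebField]
  constructor
  · rw [map_smul, polyDeriv_imagMap, hf.polyDeriv_weightMap hz.2]; simp
  -- The matrix `iW` is skew, so this inner product equals its own negative.
  · have h : ⟪z, imagMap n (weightMap b z)⟫ = -⟪z, imagMap n (weightMap b z)⟫ := by
      rw [← neg_eq_iff_eq_neg, ← inner_imagMap_left, ← inner_weightMap_left, weightMap_imagMap,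
        real_inner_comm]
    rw [inner_smul_right, self_eq_neg.1 h, mul_zero]

theorem isReebField_singularityLink (hf : IsQuasihomogeneous f b β)
    (hsing : HasIsolatedSingularity f) :
    IsReebField (singularityLink f) (weightedContactForm b) (weightedReebField b) := fun _ hp =>
  have hp0 := ne_zero_of_mem_singularityLink hp
  ⟨weightedReebField_mem_tangentSpaceAt hf hsing hp, weightedContactForm_weightedReebField hf.1 hp0,
    fun w _ => extDeriv_weightedContactForm_weightedReebField hf.1 hp0 w⟩

theorem mem_contactDistribution_singularityLink (hf : IsQuasihomogeneous f b β)
    (hsing : HasIsolatedSingularity f) {z w : CSpace n} (hz : z ∈ singularityLink f) :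
    w ∈ contactDistribution (singularityLink f) (weightedContactForm b) z ↔
      polyDeriv f z w = 0 ∧ ⟪z, w⟫ = 0 ∧ ⟪imagMap n z, w⟫ = 0 := by
  have h := weightedSquare_pos hf.1 (ne_zero_of_mem_singularityLink hz)
  change w ∈ tangentSpaceAt (singularityLink f) z ∧ weightedContactForm b z ![w] = 0 ↔ _
  rw [mem_tangentSpaceAt_singularityLink hf hsing hz, weightedContactForm_apply, and_assoc]
  simp [h.ne']

/-- The equations of `Θ` are complex: `df` is complex linear, and orthogonality to both `z` and `iz`
is stable under `i`. -/
theorem imagMap_mem_contactDistribution (hf : IsQuasihomogeneous f b β)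
    (hsing : HasIsolatedSingularity f) {z w : CSpace n} (hz : z ∈ singularityLink f)
    (hw : w ∈ contactDistribution (singularityLink f) (weightedContactForm b) z) :
    imagMap n w ∈ contactDistribution (singularityLink f) (weightedContactForm b) z := by
  rw [mem_contactDistribution_singularityLink hf hsing hz] at hw ⊢
  obtain ⟨h1, h2, h3⟩ := hw
  refine ⟨by rw [polyDeriv_imagMap, h1, mul_zero], ?_, ?_⟩
  · rw [← neg_eq_zero, ← inner_imagMap_left, h3]
  · rw [inner_imagMap_left, imagMap_imagMap, inner_neg_right, h2, neg_zero, neg_zero]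

theorem isContactForm_singularityLink (hn : 1 ≤ n) (hf : IsQuasihomogeneous f b β)
    (hsing : HasIsolatedSingularity f) :
    IsContactForm (2 * n - 1) (singularityLink f) (weightedContactForm b) := by
  refine ⟨isSmoothSubmanifold_singularityLink hn hf hsing, ⟨{0}ᶜ, isOpen_compl_singleton,
    fun z hz => ne_zero_of_mem_singularityLink hz, contDiffOn_weightedContactForm hf.1⟩, ?_⟩
  intro p hp
  have hp0 := ne_zero_of_mem_singularityLink hp
  refine ⟨⟨weightedReebField b p, weightedReebField_mem_tangentSpaceAt hf hsing hp, ?_⟩, ?_⟩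
  · rw [weightedContactForm_weightedReebField hf.1 hp0]; exact one_ne_zero
  · intro v hv h1 hv0
    have h2 := imagMap_mem_contactDistribution hf hsing hp (w := v) ⟨hv, h1⟩
    exact ⟨imagMap n v, h2.1, h2.2,
      extDeriv_weightedContactForm_imagMap_ne_zero hf.1 hp0 hv0 h1 h2.2⟩

end Link

/-! ### Fibres of the perturbed Milnor fibration near the boundary -/

section Fibres

variable {n : ℕ} {f : MvPolynomial (Fin (n + 1)) ℂ} {b : Fin (n + 1) → ℕ} {β : ℕ}
  {ψ : ℝ → ℝ} {δ : ℝ}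

theorem mem_cyclicCover (hδ : 0 < δ) {p : CSpaceProd n} :
    p ∈ cyclicCover f ψ δ β ↔ ‖p.snd‖ = 1 ∧ ‖p.fst‖ ≤ 1 ∧
      polyFun f p.fst = (ψ (‖p.fst‖ ^ 2) : ℂ) * (δ * p.snd ^ β) := by
  have h : p ∈ cyclicCover f ψ δ β ↔ ‖p.snd‖ = 1 ∧ ‖(δ : ℂ) * p.snd ^ β‖ = δ ∧ ‖p.fst‖ ≤ 1 ∧
      polyFun f p.fst = (ψ (‖p.fst‖ ^ 2) : ℂ) * (δ * p.snd ^ β) := Iff.rfl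
  rw [h]
  refine and_congr_right fun h1 => and_iff_right ?_
  simp [h1, hδ.le]

theorem mem_coverFibre (hδ : 0 < δ) {v : ℂ} (hv : ‖v‖ = 1) {z : CSpace n} :
    z ∈ coverFibre f ψ δ β v ↔ ‖z‖ ≤ 1 ∧
      polyFun f z = (ψ (‖z‖ ^ 2) : ℂ) * (δ * v ^ β) :=
  (mem_cyclicCover hδ).trans (and_iff_right hv)

theorem MilnorReeb.IsCutoff.exists_eq_zero (hψ : IsCutoff ψ) : ∃ r < 1, ∀ s ≥ r, ψ s = 0 := by
  obtain ⟨_, _, a, r, _, _, h1, _, h⟩ := hψ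
  exact ⟨r, h1, h⟩

theorem coverFibreBoundary_eq_singularityLink (hψ : IsCutoff ψ) (hδ : 0 < δ) {v : ℂ}
    (hv : ‖v‖ = 1) : coverFibreBoundary f ψ δ β v = singularityLink f := by
  obtain ⟨r, hr, h⟩ := hψ.exists_eq_zero
  ext z
  have : z ∈ coverFibreBoundary f ψ δ β v ↔
    z ∈ coverFibre f ψ δ β v ∧ z ∈ Metric.sphere (0 : CSpace n) 1 := Iff.rfl
  rw [this, mem_coverFibre hδ hv, mem_sphere_zero_iff_norm, singularityLink]
  constructor
  · rintro ⟨⟨_, h1⟩, h2⟩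
    rw [h2, one_pow, h 1 hr.le] at h1
    exact ⟨h2, by simpa using h1⟩
  · rintro ⟨h1, h2⟩
    refine ⟨⟨h1.le, ?_⟩, h1⟩
    rw [h1, one_pow, h 1 hr.le, h2]
    simp

theorem coverBoundary_eq (hψ : IsCutoff ψ) (hδ : 0 < δ) :
    coverBoundary f ψ δ β = {p | p.fst ∈ singularityLink f ∧ ‖p.snd‖ = 1} := by
  ext p
  constructor
  · rintro ⟨h1, h2⟩
    have hv := ((mem_cyclicCover hδ).1 h1).1
    refine ⟨?_, hv⟩
    rw [← coverFibreBoundary_eq_singularityLink (β := β) hψ hδ hv]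
    exact ⟨h1, mem_sphere_zero_iff_norm.2 h2⟩
  · rintro ⟨h1, hv⟩
    rw [← coverFibreBoundary_eq_singularityLink (β := β) hψ hδ hv] at h1
    exact ⟨h1.1, mem_sphere_zero_iff_norm.1 h1.2⟩

theorem singularityLink_subset_coverFibre (hψ : IsCutoff ψ) (hδ : 0 < δ) {v : ℂ}
    (hv : ‖v‖ = 1) : singularityLink f ⊆ coverFibre f ψ δ β v := by
  rw [← coverFibreBoundary_eq_singularityLink hψ hδ hv]
  exact Set.inter_subset_left

theorem eventually_cutoff_eq_zero (hψ : IsCutoff ψ) {z : CSpace n} (hz : ‖z‖ = 1) :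
    ∀ᶠ w in 𝓝 z, ψ (‖w‖ ^ 2) = 0 := by
  obtain ⟨r, hr, h⟩ := hψ.exists_eq_zero
  have hc : Continuous fun w : CSpace n => ‖w‖ ^ 2 := by fun_prop
  have : ∀ᶠ w in 𝓝 z, r < ‖w‖ ^ 2 := by
    refine (hc.tendsto z).eventually (lt_mem_nhds ?_)
    simpa [hz] using hr
  exact this.mono fun w hw => h _ hw.le

/-- At a boundary point the fibre is only half of a level set, so `tangentSpaceAt_eq_ker` does not
apply. Instead the kernel of `df` is generated by the tangent space of the link and the Euler
vector, the latter being the velocity of a dilation curve. -/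
theorem mem_tangentSpaceAt_coverFibre (hf : IsQuasihomogeneous f b β)
    (hsing : HasIsolatedSingularity f) (hψ : IsCutoff ψ) (hδ : 0 < δ) {v : ℂ}
    (hv : ‖v‖ = 1) {z w : CSpace n} (hz : z ∈ singularityLink f) :
    w ∈ tangentSpaceAt (coverFibre f ψ δ β v) z ↔ polyDeriv f z w = 0 := by
  have hev := eventually_cutoff_eq_zero hψ hz.1
  have hz0 := ne_zero_of_mem_singularityLink hz
  constructor
  · refine fun hw => tangentSpaceAt_le_ker hev (hasStrictFDerivAt_polyFun f z).hasFDerivAt ?_ hw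
    rintro q ⟨hq, hq'⟩
    have hq0 : ψ (‖q‖ ^ 2) = 0 := hq'
    rw [((mem_coverFibre hδ hv).1 hq).2, hq0, hz.2]
    simp
  · intro hw
    have hE : weightMap b z ∈ tangentSpaceAt (coverFibre f ψ δ β v) z := by
      have hd := hasDerivAt_dilationCurve b z
      have hc := hd.continuousAt.tendsto
      rw [dilationCurve_zero] at hc
      have hmem := hc.eventually hev
      rw [← dilationCurve_zero b z]
      -- Times `s ≤ 0` keep the curve in the unit ball, and the second set keeps it where the cutoff
      -- vanishes.
      refine deriv_mem_tangentSpaceAt (S := Set.Iic 0 ∩ {s | ψ (‖dilationCurve b z s‖ ^ 2) = 0})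
        (by rwa [dilationCurve_zero]) ?_
        ((uniqueDiffWithinAt_inter hmem).2 (uniqueDiffOn_Iic 0 0 Set.self_mem_Iic))
      rintro s ⟨hs, hs'⟩
      have hs0 : ψ (‖dilationCurve b z s‖ ^ 2) = 0 := hs'
      rw [mem_coverFibre hδ hv, hs0, hf.polyFun_dilationCurve hz.2]
      exact ⟨(norm_dilationCurve_le b z hs).trans hz.1.le, by simp⟩
    have hpos := (inner_weightMap_self_pos hf.1 hz0).ne'
    set c := ⟪z, w⟫ / ⟪z, weightMap b z⟫ with hc
    have h1 : w - c • weightMap b z ∈ tangentSpaceAt (singularityLink f) z := by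
      rw [mem_tangentSpaceAt_singularityLink hf hsing hz]
      refine ⟨by rw [map_sub, map_smul, hw, hf.polyDeriv_weightMap hz.2]; simp, ?_⟩
      rw [inner_sub_right, inner_smul_right, hc, div_mul_cancel₀ _ hpos, sub_self]
    have h2 := tangentSpaceAt_mono_of_subset
      (singularityLink_subset_coverFibre (f := f) (β := β) hψ hδ hv) z h1
    simpa using Submodule.add_mem _ h2 (Submodule.smul_mem _ c hE)

theorem gradient_norm_of_norm_eq_one {z : CSpace n} (hz : ‖z‖ = 1) :
    gradient (fun w : CSpace n => ‖w‖) z = z := by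
  have h := (hasStrictFDerivAt_norm_sq z).hasFDerivAt.sqrt (by simp [hz])
  have h2 : HasGradientAt (fun w : CSpace n => ‖w‖) z z := by
    rw [hasGradientAt_iff_hasFDerivAt]
    have e : (fun w : CSpace n => √(‖w‖ ^ 2)) = fun w => ‖w‖ := by
      ext w; exact Real.sqrt_sq (norm_nonneg w)
    rw [e] at h
    refine h.congr_fderiv ?_
    ext w
    simp [hz]
  exact h2.gradient

theorem inner_radialGradient (F : Set (CSpace n)) {z w : CSpace n} (hz : ‖z‖ = 1)
    (hw : w ∈ tangentSpaceAt F z) : ⟪radialGradient F z, w⟫ = ⟪z, w⟫ := by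
  rw [radialGradient, gradient_norm_of_norm_eq_one hz, Submodule.inner_starProjection_left_eq_right,
    Submodule.starProjection_eq_self_iff.2 hw]

theorem radialGradient_mem (F : Set (CSpace n)) (z : CSpace n) :
    radialGradient F z ∈ tangentSpaceAt F z :=
  Submodule.starProjection_apply_mem _ _

/-- The vector `N` is orthogonal to the whole tangent space of the link, as `z` is. Within that
space `B` need not be orthogonal to `Θ`, and `η` rather than the metric separates the two. -/
theorem boundary_splitting (hf : IsQuasihomogeneous f b β)
    (hsing : HasIsolatedSingularity f) (hψ : IsCutoff ψ) (hδ : 0 < δ) {v : ℂ}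
    (hv : ‖v‖ = 1) {z : CSpace n} (hz : z ∈ singularityLink f) :
    radialGradient (coverFibre f ψ δ β v) z ≠ 0 ∧
    iSupIndep ![Submodule.span ℝ {radialGradient (coverFibre f ψ δ β v) z},
      Submodule.span ℝ {weightedReebField b z},
      contactDistribution (singularityLink f) (weightedContactForm b) z] ∧
    Submodule.span ℝ {radialGradient (coverFibre f ψ δ β v) z} ⊔
      Submodule.span ℝ {weightedReebField b z} ⊔
      contactDistribution (singularityLink f) (weightedContactForm b) z =
        tangentSpaceAt (coverFibre f ψ δ β v) z ∧
    ∀ w ∈ contactDistribution (singularityLink f) (weightedContactForm b) z,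
      ⟪radialGradient (coverFibre f ψ δ β v) z, w⟫ = 0 := by
  set F := coverFibre f ψ δ β v
  set N := radialGradient F z with hN
  set B := weightedReebField b z
  set Θ := contactDistribution (singularityLink f) (weightedContactForm b) z
  have hz0 := ne_zero_of_mem_singularityLink hz
  have hTF : ∀ {w}, w ∈ tangentSpaceAt F z ↔ polyDeriv f z w = 0 :=
    fun {w} => mem_tangentSpaceAt_coverFibre hf hsing hψ hδ hv hz
  have hsub : ∀ w ∈ tangentSpaceAt (singularityLink f) z, w ∈ tangentSpaceAt F z := fun w hw =>
    hTF.2 ((mem_tangentSpaceAt_singularityLink hf hsing hz).1 hw).1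
  have hNF : N ∈ tangentSpaceAt F z := radialGradient_mem F z
  have hperp : ∀ w ∈ tangentSpaceAt (singularityLink f) z, ⟪N, w⟫ = 0 := fun w hw => by
    rw [hN, inner_radialGradient F hz.1 (hsub w hw)]
    exact ((mem_tangentSpaceAt_singularityLink hf hsing hz).1 hw).2
  have hN0 : N ≠ 0 := by
    intro h0
    have h1 := inner_radialGradient F hz.1 (hTF.2 (hf.polyDeriv_weightMap hz.2))
    rw [← hN, h0, inner_zero_left] at h1
    exact (inner_weightMap_self_pos hf.1 hz0).ne h1
  have hNN : ⟪N, N⟫ ≠ 0 := inner_self_ne_zero.2 hN0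
  have hB : B ∈ tangentSpaceAt (singularityLink f) z :=
    weightedReebField_mem_tangentSpaceAt hf hsing hz
  have hηB : weightedContactForm b z ![B] = 1 := weightedContactForm_weightedReebField hf.1 hz0
  have hη : ∀ c w, weightedContactForm b z ![w + c • B] = weightedContactForm b z ![w] + c := by
    intro c w
    rw [weightedContactForm_apply] at hηB
    rw [weightedContactForm_apply, weightedContactForm_apply, inner_add_right, inner_smul_right]
    linear_combination c * hηB
  refine ⟨hN0, ?_, ?_, fun w hw => hperp w hw.1⟩
  -- Pairing a relation with `N` isolates `c`; applying `η` to the rest isolates `a`.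
  · have key : ∀ c a : ℝ, ∀ w ∈ Θ, c • N + a • B + w = 0 → c = 0 ∧ a = 0 ∧ w = 0 := by
      intro c a w hw h
      have h1 : ⟪N, c • N + a • B + w⟫ = 0 := by rw [h, inner_zero_right]
      rw [inner_add_right, inner_add_right, inner_smul_right, inner_smul_right, hperp B hB,
        hperp w hw.1, mul_zero, add_zero, add_zero] at h1
      obtain rfl : c = 0 := (mul_eq_zero.1 h1).resolve_right hNN
      rw [zero_smul, zero_add, add_comm] at h
      have h2 := hη a w
      rw [h, hw.2, zero_add, weightedContactForm_apply, inner_zero_right, mul_zero] at h2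
      subst h2
      exact ⟨rfl, rfl, by simpa using h⟩
    have hΘ : ∀ w ∈ Θ, -w ∈ Θ := fun w hw => Submodule.neg_mem _ hw
    rw [iSupIndep_fin_three]
    simp only [Matrix.cons_val, Submodule.disjoint_def, Submodule.mem_sup,
      Submodule.mem_span_singleton]
    refine ⟨?_, ?_, ?_⟩
    · rintro _ ⟨c, rfl⟩ ⟨_, ⟨a, rfl⟩, w, hw, h⟩
      rw [(key c (-a) (-w) (hΘ w hw) (by rw [← h]; module)).1, zero_smul]
    · rintro _ ⟨a, rfl⟩ ⟨w, hw, _, ⟨c, rfl⟩, h⟩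
      rw [(key (-c) a (-w) (hΘ w hw) (by rw [← h]; module)).2.1, zero_smul]
    · rintro w hw ⟨_, ⟨c, rfl⟩, _, ⟨a, rfl⟩, h⟩
      exact (key (-c) (-a) w hw (by rw [← h]; module)).2.2
  · apply le_antisymm
    · refine sup_le (sup_le ?_ ?_) fun w hw => hsub w hw.1
      · exact (Submodule.span_singleton_le_iff_mem _ _).2 hNF
      · exact (Submodule.span_singleton_le_iff_mem _ _).2 (hsub B hB)
    · intro w hw
      set c := ⟪N, w⟫ / ⟪N, N⟫ with hc
      set u := w - c • N with hu
      have huT : u ∈ tangentSpaceAt (singularityLink f) z := by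
        have huF : u ∈ tangentSpaceAt F z := Submodule.sub_mem _ hw (Submodule.smul_mem _ c hNF)
        rw [mem_tangentSpaceAt_singularityLink hf hsing hz]
        refine ⟨hTF.1 huF, ?_⟩
        rw [← inner_radialGradient F hz.1 huF, ← hN, hu, inner_sub_right, inner_smul_right, hc,
          div_mul_cancel₀ _ hNN, sub_self]
      set a := weightedContactForm b z ![u] with ha
      have huΘ : u + (-a) • B ∈ Θ :=
        ⟨Submodule.add_mem _ huT (Submodule.smul_mem _ _ hB), by rw [hη]; simp [ha]⟩
      have hw' : w = c • N + a • B + (u + (-a) • B) := by rw [hu]; module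
      rw [hw']
      exact Submodule.add_mem_sup (Submodule.add_mem_sup (Submodule.mem_span_singleton.2 ⟨c, rfl⟩)
        (Submodule.mem_span_singleton.2 ⟨a, rfl⟩)) huΘ

end Fibres

/-! ### The Reeb flow -/

section ReebFlow

variable {n : ℕ}

/-- The action of the circle `ℝ/ℤ` with the weights `b`. -/
noncomputable def circleFlow (b : Fin (n + 1) → ℕ) (t : AddCircle (1 : ℝ)) (z : CSpace n) :
    CSpace n :=
  diagMap (fun i => (AddCircle.toCircle t : ℂ) ^ b i) z

theorem circleFlow_circleFlow (b : Fin (n + 1) → ℕ) (s t : AddCircle (1 : ℝ)) (z : CSpace n) :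
    circleFlow b s (circleFlow b t z) = circleFlow b (s + t) z := by
  simp only [circleFlow, diagMap_diagMap, ← mul_pow, AddCircle.toCircle_add, Circle.coe_mul]

theorem circleFlow_zero (b : Fin (n + 1) → ℕ) (z : CSpace n) : circleFlow b 0 z = z := by
  ext i; simp [circleFlow]

theorem norm_circleFlow (b : Fin (n + 1) → ℕ) (t : AddCircle (1 : ℝ)) (z : CSpace n) :
    ‖circleFlow b t z‖ = ‖z‖ :=
  norm_diagMap (fun i => by rw [norm_pow, Circle.norm_coe, one_pow]) z

theorem circleFlow_coe (b : Fin (n + 1) → ℕ) (t : ℝ) (z : CSpace n) :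
    circleFlow b t z = weightedCircleAction b t z := by
  ext i
  simp only [circleFlow, diagMap_apply, AddCircle.toCircle_apply_mk, Circle.coe_exp,
    weightedCircleAction, ← Complex.exp_nat_mul]
  congr 2
  push_cast
  ring

theorem hasDerivAt_circleFlow (b : Fin (n + 1) → ℕ) (t : ℝ) (z : CSpace n) :
    HasDerivAt (fun s : ℝ => circleFlow b s z) (weightedReebField b (circleFlow b t z)) t := by
  simp only [circleFlow_coe]
  refine hasDerivAt_of_coord fun i => ?_
  have h1 : HasDerivAt (fun s : ℝ => 2 * Real.pi * Complex.I * s * b i)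
      (2 * Real.pi * Complex.I * b i) t := by
    have := (((hasDerivAt_id t).ofReal_comp).const_mul (2 * Real.pi * Complex.I)).mul_const
      (b i : ℂ)
    simpa using this
  refine (h1.cexp.mul_const (z i)).congr_deriv ?_
  simp [weightedReebField, weightedCircleAction]
  ring

theorem circleFlow_mem_singularityLink {f : MvPolynomial (Fin (n + 1)) ℂ} {b : Fin (n + 1) → ℕ}
    {β : ℕ} (hf : IsQuasihomogeneous f b β) (t : AddCircle (1 : ℝ)) {z : CSpace n} :
    circleFlow b t z ∈ singularityLink f ↔ z ∈ singularityLink f := by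
  have hc : (AddCircle.toCircle t : ℂ) ≠ 0 := Circle.coe_ne_zero _
  simp only [singularityLink, Set.mem_ofPred_eq, circleFlow]
  rw [hf.polyFun_diagMap hc, ← circleFlow, norm_circleFlow]
  simp

theorem isCircleFlow_circleFlow {f : MvPolynomial (Fin (n + 1)) ℂ} {b : Fin (n + 1) → ℕ}
    {β : ℕ} (hf : IsQuasihomogeneous f b β) :
    IsCircleFlow (singularityLink f) (weightedReebField b) (circleFlow b) := by
  refine fun p hp => ⟨circleFlow_zero b p, fun t => ⟨(circleFlow_mem_singularityLink hf _).2 hp,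
    hasDerivAt_circleFlow b t p⟩⟩

/-- The Reeb field is linear, hence globally Lipschitz, and its integral curves are unique. -/
theorem eq_circleFlow_of_hasDerivAt {b : Fin (n + 1) → ℕ} {γ : ℝ → CSpace n}
    (hγ : ∀ t, HasDerivAt γ (weightedReebField b (γ t)) t) (t : ℝ) :
    γ t = circleFlow b t (γ 0) := by
  have hL : LipschitzWith ‖(2 * Real.pi) • (imagMap n).comp (weightMap b)‖₊
      (weightedReebField b) :=
    ((2 * Real.pi) • (imagMap n).comp (weightMap b)).lipschitz
  refine congrFun (ODE_solution_unique_univ (v := fun _ => weightedReebField b) (s := fun _ => Set.univ)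
    (t₀ := 0) (fun _ => hL.lipschitzOnWith) (fun t => ⟨hγ t, Set.mem_univ _⟩)
    (fun t => ⟨hasDerivAt_circleFlow b t (γ 0), Set.mem_univ _⟩) ?_) t
  exact (circleFlow_zero b (γ 0)).symm

theorem leaf_singularityLink {f : MvPolynomial (Fin (n + 1)) ℂ} {b : Fin (n + 1) → ℕ}
    {β : ℕ} (hf : IsQuasihomogeneous f b β) {p : CSpace n} (hp : p ∈ singularityLink f) :
    leaf (singularityLink f) (weightedReebField b) p = Set.range fun t : ℝ => circleFlow b t p := by
  ext q
  constructor
  · rintro ⟨γ, hγ, rfl, t, rfl⟩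
    exact ⟨t, (eq_circleFlow_of_hasDerivAt (fun t => (hγ t).2) t).symm⟩
  · rintro ⟨t, rfl⟩
    have h := isCircleFlow_circleFlow hf p hp
    exact ⟨fun s => circleFlow b s p, h.2, h.1, t, rfl⟩

/-- The orbits of a weighted circle action away from the origin are circles. -/
theorem nonempty_range_circleFlow_homeomorph {b : Fin (n + 1) → ℕ} (hb : ∀ i, 0 < b i)
    {p : CSpace n} (hp : p ≠ 0) :
    Nonempty ((Set.range fun t : ℝ => circleFlow b t p) ≃ₜ Circle) := by
  set s : Finset (Fin (n + 1)) := Finset.univ.filter fun i => p i ≠ 0 with hs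
  -- The circle acts on the orbit of `p` with kernel the `d`-th roots of unity, `d` being the gcd of
  -- the weights of the nonzero coordinates. Dividing these weights by `d` gives an injective
  -- parametrization `g`.
  set d := s.gcd b with hd
  obtain ⟨j, hj⟩ : ∃ j, p j ≠ 0 := by
    by_contra! h0
    exact hp (by ext i; simpa using h0 i)
  have hjs : j ∈ s := by simp [hs, hj]
  have hd0 : 0 < d := Nat.pos_of_dvd_of_pos (Finset.gcd_dvd hjs) (hb j)
  have hdb : ∀ i ∈ s, d * (b i / d) = b i := fun i hi => Nat.mul_div_cancel' (Finset.gcd_dvd hi)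
  let g : Circle → CSpace n := fun u => diagMap (fun i => (u : ℂ) ^ (b i / d)) p
  have hcont : Continuous g := by
    refine (PiLp.continuous_toLp 2 _).comp (continuous_pi fun i => ?_)
    exact (continuous_subtype_val.pow _).mul continuous_const
  have hinj : Function.Injective g := by
    intro u w huw
    have h1 : ∀ i ∈ s, (u / w) ^ (b i / d) = 1 := by
      intro i hi
      have h := congrArg (fun z : CSpace n => z i) huw
      simp only [g, diagMap_apply] at h
      have h2 := mul_right_cancel₀ (Finset.mem_filter.1 hi).2 h
      rw [div_pow, div_eq_one]
      exact Circle.ext (by simpa using h2)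
    -- The order of `u / w` divides every reduced weight, and these have gcd `1`.
    have h2 : orderOf (u / w) ∣ s.gcd fun i => b i / d :=
      Finset.dvd_gcd fun i hi => orderOf_dvd_of_pow_eq_one (h1 i hi)
    rw [Finset.gcd_div_eq_one hjs (hb j).ne', Nat.dvd_one, orderOf_eq_one_iff, div_eq_one] at h2
    exact h2
  have hg : ∀ t : ℝ, g (AddCircle.toCircle (t : AddCircle (1 : ℝ)) ^ d) = circleFlow b t p := by
    intro t
    ext i
    by_cases hi : p i = 0
    · simp [g, circleFlow, hi]
    · simp only [g, circleFlow, diagMap_apply, Circle.coe_pow, ← pow_mul]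
      rw [hdb i (by simp [hs, hi])]
  have hrange : Set.range g = Set.range fun t : ℝ => circleFlow b t p := by
    refine Set.Subset.antisymm ?_ (Set.range_subset_iff.2 fun t => ⟨_, hg t⟩)
    rintro _ ⟨u, rfl⟩
    -- The time `t` is chosen so that `e^{2πi t d} = u`.
    refine ⟨Complex.arg u / (2 * Real.pi * d), ?_⟩
    simp only [← hg]
    congr 1
    rw [AddCircle.toCircle_apply_mk]
    nth_rw 2 [← Circle.exp_arg u]
    apply Circle.ext
    rw [Circle.coe_pow, Circle.coe_exp, Circle.coe_exp, ← Complex.exp_nat_mul]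
    have : (d : ℂ) ≠ 0 := by exact_mod_cast hd0.ne'
    have := Complex.ofReal_ne_zero.2 Real.pi_ne_zero
    congr 1
    push_cast
    field_simp
  rw [← hrange]
  exact ⟨((hcont.isClosedEmbedding hinj).toHomeomorph).symm⟩

end ReebFlow

/-! ### The monodromy on the boundary -/

section Monodromy

variable {n : ℕ}

/-- The times in the first factor add up to `t + 1/β - t`, and the rotations of `v` cancel. The
branch of the argument is thus irrelevant, and the equality holds on the whole ambient space. -/
theorem coverMonodromy_eq_productFlow (b : Fin (n + 1) → ℕ) (β : ℕ) (x : ℂ) :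
    coverMonodromy b β x =
      productFlow (circleFlow b) ((1 / (β : ℝ) : ℝ) : AddCircle (1 : ℝ)) := by
  funext p
  have hadd : ∀ (s t : ℝ) (z : CSpace n), weightedCircleAction b s (weightedCircleAction b t z) =
      weightedCircleAction b (s + t) z := by
    intro s t z
    ext i
    simp only [weightedCircleAction]
    rw [← mul_assoc, ← Complex.exp_add]
    congr 2
    push_cast
    ring
  simp only [coverMonodromy, liftedCircleAction, fibreMonodromy, productFlow, circleFlow_coe]
  congr 2
  · change weightedCircleAction b _ (weightedCircleAction b _ (weightedCircleAction b _ _)) = _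
    rw [hadd, hadd]
    congr 1
    ring
  · change _ * (_ * p.snd) = p.snd
    rw [← mul_assoc, ← Complex.exp_add, Complex.ofReal_neg, mul_neg, add_neg_cancel,
      Complex.exp_zero, one_mul]

/-- The time `t` map of the product flow as a linear isometry. -/
noncomputable def productFlowIsometry (b : Fin (n + 1) → ℕ) (t : AddCircle (1 : ℝ)) :
    CSpaceProd n ≃ₗᵢ[ℝ] CSpaceProd n where
  toFun := productFlow (circleFlow b) t
  invFun := productFlow (circleFlow b) (-t)
  map_add' p q := by simp [productFlow, circleFlow, ← WithLp.toLp_add]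
  map_smul' r p := by simp [productFlow, circleFlow, ← WithLp.toLp_smul]
  left_inv p := by simp [productFlow, circleFlow_circleFlow, circleFlow_zero]; rfl
  right_inv p := by simp [productFlow, circleFlow_circleFlow, circleFlow_zero]; rfl
  norm_map' p := by
    change ‖productFlow (circleFlow b) t p‖ = ‖p‖
    rw [WithLp.prod_norm_eq_of_L2, WithLp.prod_norm_eq_of_L2]
    simp [productFlow, norm_circleFlow]

/-- The monodromy and the Reeb flow act by the same bounded operator on the square integrable forms
on the boundary of the cyclic cover. -/
theorem exists_monodromy_operator {f : MvPolynomial (Fin (n + 1)) ℂ} {b : Fin (n + 1) → ℕ} {β : ℕ}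
    (hf : IsQuasihomogeneous f b β) {ψ : ℝ → ℝ} (hψ : IsCutoff ψ) {δ : ℝ} (hδ : 0 < δ) (x : ℂ) :
    ∃ T : L2Forms (2 * n) (coverBoundary f ψ δ β) →L[ℂ]
        L2Forms (2 * n) (coverBoundary f ψ δ β),
      IsPullbackOperator (coverMonodromy b β x) T ∧
      IsPullbackOperator
        (productFlow (circleFlow b) ((1 / (β : ℝ) : ℝ) : AddCircle (1 : ℝ))) T := by
  obtain ⟨T, hT⟩ := exists_isPullbackOperator_isometry
    (productFlowIsometry b ((1 / (β : ℝ) : ℝ) : AddCircle (1 : ℝ)))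
    (M := coverBoundary f ψ δ β) (fun p => by
      rw [coverBoundary_eq hψ hδ]
      exact and_congr_left fun _ => circleFlow_mem_singularityLink hf _) (2 * n)
  have hφ : ⇑(productFlowIsometry b ((1 / (β : ℝ) : ℝ) : AddCircle (1 : ℝ))) =
      productFlow (circleFlow b) ((1 / (β : ℝ) : ℝ) : AddCircle (1 : ℝ)) := rfl
  rw [hφ] at hT
  have hρ : IsPullbackOperator (coverMonodromy b β x) T :=
    (congrArg (fun φ => IsPullbackOperator φ T) (coverMonodromy_eq_productFlow b β x)).mpr hT
  exact ⟨T, hρ, hT⟩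

end Monodromy

theorem corollary4p3 (n : ℕ) (hn : 1 ≤ n) (f : MvPolynomial (Fin (n + 1)) ℂ)
    (b : Fin (n + 1) → ℕ) (β : ℕ) (hf : IsQuasihomogeneous f b β)
    (hsing : HasIsolatedSingularity f) (ψ : ℝ → ℝ) (hψ : IsCutoff ψ)
    (δ : ℝ) (hδ : 0 < δ) (x : ℂ) (hx : ‖x‖ = 1) :
    ∃ (η : CSpace n → CSpace n [⋀^Fin 1]→L[ℝ] ℝ) (B : CSpace n → CSpace n)
      (σ : AddCircle (1 : ℝ) → CSpace n → CSpace n),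
      -- contact form, Reeb field and splitting on the boundary of every fibre
      (∀ v : ℂ, ‖v‖ = 1 →
        coverFibreBoundary f ψ δ β v = coverFibreBoundary f ψ δ β x ∧
        IsContactForm (2 * n - 1) (coverFibreBoundary f ψ δ β v) η ∧
        IsReebField (coverFibreBoundary f ψ δ β v) η B ∧
        ∀ p ∈ coverFibreBoundary f ψ δ β v,
          radialGradient (coverFibre f ψ δ β v) p ≠ 0 ∧
          iSupIndep ![Submodule.span ℝ {radialGradient (coverFibre f ψ δ β v) p},
            Submodule.span ℝ {B p},
            contactDistribution (coverFibreBoundary f ψ δ β v) η p] ∧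
          Submodule.span ℝ {radialGradient (coverFibre f ψ δ β v) p} ⊔
            Submodule.span ℝ {B p} ⊔
            contactDistribution (coverFibreBoundary f ψ δ β v) η p =
              tangentSpaceAt (coverFibre f ψ δ β v) p ∧
          ∀ w ∈ contactDistribution (coverFibreBoundary f ψ δ β v) η p,
            ⟪radialGradient (coverFibre f ψ δ β v) p, w⟫ = 0) ∧
      -- the leaves of the Reeb foliation are closed curves
      (∀ p ∈ coverFibreBoundary f ψ δ β x,
        Nonempty (leaf (coverFibreBoundary f ψ δ β x) B p ≃ₜ Circle)) ∧
      -- the Reeb flow as a flow of the circle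
      IsCircleFlow (coverFibreBoundary f ψ δ β x) B σ ∧
      -- the canonical trivialization of the boundary
      coverBoundary f ψ δ β =
        {p | p.fst ∈ coverFibreBoundary f ψ δ β x ∧ ‖p.snd‖ = 1} ∧
      -- equality of the two bounded operators on square integrable forms
      ∃ T : L2Forms (2 * n) (coverBoundary f ψ δ β) →L[ℂ]
          L2Forms (2 * n) (coverBoundary f ψ δ β),
        IsPullbackOperator (coverMonodromy b β x) T ∧
        IsPullbackOperator (productFlow σ ((1 / (β : ℝ) : ℝ) : AddCircle (1 : ℝ))) T := by
  -- All fibre boundaries are one and the same set, which lets a single `η`, `B` and `σ` serve every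
  -- `v`.
  have hbd : ∀ v : ℂ, ‖v‖ = 1 → coverFibreBoundary f ψ δ β v = singularityLink f :=
    fun v hv => coverFibreBoundary_eq_singularityLink hψ hδ hv
  refine ⟨weightedContactForm b, weightedReebField b, circleFlow b, fun v hv => ?_, ?_⟩
  · rw [hbd v hv, hbd x hx]
    exact ⟨rfl, isContactForm_singularityLink hn hf hsing, isReebField_singularityLink hf hsing,
      fun p hp => boundary_splitting hf hsing hψ hδ hv hp⟩
  · rw [hbd x hx]
    refine ⟨fun p hp => ?_, isCircleFlow_circleFlow hf, coverBoundary_eq hψ hδ, ?_⟩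
    · rw [leaf_singularityLink hf hp]
      exact nonempty_range_circleFlow_homeomorph hf.1 (ne_zero_of_mem_singularityLink hp)
    · exact exists_monodromy_operator hf hψ hδ x
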